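/- Let $n\ge 0$ and let $(W,S)$ be a Coxeter system of type $\mathrm{B}_n$, with $S=\{s_0,\dots,s_{n-1}\}$ labelled so that $s_0s_1$ has order $4$ and $s_is_{i+1}$ has order $3$ for $i\ge 1$. Let $I=\{s_1,\dots,s_{n-1}\}$ (type $\mathrm{A}_{n-1}$), and let ${}^IW$ be the set of minimal length representatives of the cosets $W_I\backslash W$. Let $H$ be the Hecke algebra of $(W,S)$ over $\mathbb Z[v,v^{-1}]$, with generators $\delta_x$ ($x\in W$) and relations $\delta_{\mathrm{id}}=1$, $\delta_x\delta_y=\delta_{xy}$ if $\ell(x)+\ell(y)=\ell(xy)$, and $(\delta_s+v)(\delta_s-v^{-1})=0$ for $s\in S$. Put $b_s=\delta_s+v$. Let ${}^IN=\mathrm{sgn}\otimes_{H_I}H$ be the antispherical right $H$-module, where $\delta_s$ acts on $\mathrm{sgn}$ by $-v$ for $s\in I$, and write $\delta^I_x=1\otimes\delta_x$ for $x\in{}^IW$. The involution of $H$ given by $\overline v=v^{-1}$, $\overline{\delta_x}=\delta_{x^{-1}}^{-1}$ induces an involution of ${}^IN$. There is a unique family $(d_x)_{x\in{}^IW}$ in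 ${}^IN$ (the Kazhdan–Lusztig basis) such that $\overline{d_x}=d_x$ and $d_x\in\delta^I_x+\sum_{y\in{}^IW,\,y<x}v\mathbb Z[v]\,\delta^I_y$ for all $x$, where $<$ is the Bruhat order. For an expression $\underline x=(s_{i_1},\dots,s_{i_k})$ put $d_{\underline x}=d_{\mathrm{id}}\,b_{s_{i_1}}\cdots b_{s_{i_k}}$. Identify ${}^IW$ with the set of subsets of $\{1,\dots,n\}$ by sending $x=s_{i_1}\cdots s_{i_k}$ to the subset obtained from $\emptyset$ by applying $s_{i_1}$, then $s_{i_2}$, and so on, where $s_0$ adds or removes the element $1$ and $s_i$ ($i\ge1$) exchanges $i$ and $i+1$. For $x\subseteq\{1,\dots,n\}$ let $$E(x)=\bigl\{t\in x \;:\; t\text{ is even and } |\{t'\in x: t\ge t'\ge k\}|>|\{t'\notin x: t\ge t'\ge k\}| \text{ for all } t>k\ge1\bigr\}.$$ Then for every $x\in{}^IW$ and every reduced expression $\underline x$ of $x$, $$d_{\underline x}=\sum_{E\subseteq E(x)}d_{x\setminus E}.$$ -/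

import Mathlib

open scoped LaurentPolynomial RightActions

noncomputable section

namespace Antispherical

/-! ### Coxeter systems: Bruhat order and minimal coset representatives -/

section Coxeter

variable {B : Type*} {M : CoxeterMatrix B} {W : Type*} [Group W] (cs : CoxeterSystem M W)

/-- The strict Bruhat order: the transitive closure of `y < y t` for reflections `t` with
`ℓ(y) < ℓ(y t)`. -/
def BruhatLT : W → W → Prop :=
  Relation.TransGen fun y z => ∃ t, cs.IsReflection t ∧ z = y * t ∧ cs.length y < cs.length z

/-- The standard parabolic subgroup `W_I`. -/
def parabolic (I : Set B) : Subgroup W := Subgroup.closure (cs.simple '' I)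

/-- `ᴵW`: the elements of `W` that have minimal length in their coset `W_I w`. -/
def MinCosetRep (I : Set B) : Type _ :=
  {w : W // ∀ u ∈ parabolic cs I, cs.length w ≤ cs.length (u * w)}

end Coxeter

/-! ### The Hecke algebra -/

section Hecke

variable {B : Type*} {M : CoxeterMatrix B} {W : Type*} [Group W] (cs : CoxeterSystem M W)

/-- The symbol `δ_x` in the free `ℤ[v, v⁻¹]`-algebra, where `v = T 1`. -/
abbrev symb {W : Type*} (x : W) : FreeAlgebra ℤ[T;T⁻¹] W := FreeAlgebra.ι ℤ[T;T⁻¹] x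

/-- The scalar `v ^ k` in the free algebra. -/
abbrev freeV (W : Type*) (k : ℤ) : FreeAlgebra ℤ[T;T⁻¹] W :=
  algebraMap ℤ[T;T⁻¹] (FreeAlgebra ℤ[T;T⁻¹] W) (LaurentPolynomial.T k)

/-- The defining relations of the Hecke algebra: `δ_id = 1`, `δ_x δ_y = δ_{xy}` if
`ℓ(x) + ℓ(y) = ℓ(xy)`, and `(δ_s + v)(δ_s - v⁻¹) = 0`. -/
inductive HeckeRel : FreeAlgebra ℤ[T;T⁻¹] W → FreeAlgebra ℤ[T;T⁻¹] W → Prop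
  | one : HeckeRel (symb 1) 1
  | mul (x y : W) (h : cs.length x + cs.length y = cs.length (x * y)) :
      HeckeRel (symb x * symb y) (symb (x * y))
  | quad (i : B) :
      HeckeRel ((symb (cs.simple i) + freeV W 1) * (symb (cs.simple i) - freeV W (-1))) 0

/-- The Hecke algebra `H` of a Coxeter system, by generators and relations. -/
def Hecke : Type _ := RingQuot (HeckeRel cs)

instance : Ring (Hecke cs) := inferInstanceAs (Ring (RingQuot (HeckeRel cs)))

instance : Algebra ℤ[T;T⁻¹] (Hecke cs) :=
  inferInstanceAs (Algebra ℤ[T;T⁻¹] (RingQuot (HeckeRel cs)))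

/-- The projection from the free algebra to the Hecke algebra. -/
def proj : FreeAlgebra ℤ[T;T⁻¹] W →ₐ[ℤ[T;T⁻¹]] Hecke cs := RingQuot.mkAlgHom ℤ[T;T⁻¹] (HeckeRel cs)

theorem proj_rel {p q : FreeAlgebra ℤ[T;T⁻¹] W} (h : HeckeRel cs p q) : proj cs p = proj cs q :=
  RingQuot.mkAlgHom_rel ℤ[T;T⁻¹] h

/-- The universal property of the Hecke algebra. -/
def heckeLift {A : Type*} [Ring A] [Algebra ℤ[T;T⁻¹] A] (f : W → A)
    (hf : ∀ p q, HeckeRel cs p q →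
      FreeAlgebra.lift ℤ[T;T⁻¹] f p = FreeAlgebra.lift ℤ[T;T⁻¹] f q) :
    Hecke cs →ₐ[ℤ[T;T⁻¹]] A :=
  RingQuot.liftAlgHom ℤ[T;T⁻¹] ⟨FreeAlgebra.lift ℤ[T;T⁻¹] f, fun p q h => hf p q h⟩

/-- The standard generators `δ_x` of the Hecke algebra. -/
def δ (x : W) : Hecke cs := proj cs (symb x)

theorem heckeLift_δ {A : Type*} [Ring A] [Algebra ℤ[T;T⁻¹] A] (f : W → A) (hf) (x : W) :
    heckeLift cs f hf (δ cs x) = f x := by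
  refine (RingQuot.liftAlgHom_mkAlgHom_apply _ _ _ _).trans ?_
  exact FreeAlgebra.lift_ι_apply _ _

/-- The scalar `p ∈ ℤ[v, v⁻¹]` in the Hecke algebra. -/
def scalar (p : ℤ[T;T⁻¹]) : Hecke cs := algebraMap ℤ[T;T⁻¹] (Hecke cs) p

theorem scalar_comm (p : ℤ[T;T⁻¹]) (h : Hecke cs) : scalar cs p * h = h * scalar cs p :=
  Algebra.commutes _ _

theorem δ_one : δ cs 1 = 1 := by
  rw [δ, proj_rel cs HeckeRel.one, map_one]

theorem δ_mul (x y : W) (h : cs.length x + cs.length y = cs.length (x * y)) :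
    δ cs x * δ cs y = δ cs (x * y) := by
  rw [δ, δ, δ, ← proj_rel cs (HeckeRel.mul x y h), map_mul]

theorem δ_quad (i : B) :
    (δ cs (cs.simple i) + scalar cs (LaurentPolynomial.T 1)) *
      (δ cs (cs.simple i) - scalar cs (LaurentPolynomial.T (-1))) = 0 := by
  have h := proj_rel cs (HeckeRel.quad i)
  rwa [map_mul, map_add, map_sub, AlgHom.commutes, AlgHom.commutes, map_zero] at h

theorem scalar_T_mul (k : ℤ) :
    scalar cs (LaurentPolynomial.T k) * scalar cs (LaurentPolynomial.T (-k)) = 1 := by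
  rw [scalar, scalar, ← map_mul, ← LaurentPolynomial.T_add]; simp

theorem δ_simple_mul_inv (i : B) :
    δ cs (cs.simple i) * (δ cs (cs.simple i) + scalar cs (LaurentPolynomial.T 1) -
      scalar cs (LaurentPolynomial.T (-1))) = 1 := by
  have h := δ_quad cs i
  have h1 := scalar_T_mul cs 1
  simp only [add_mul, mul_sub, mul_add] at h ⊢
  rw [h1, scalar_comm] at h
  rw [← sub_eq_zero, ← h]; abel

theorem δ_simple_inv_mul (i : B) :
    (δ cs (cs.simple i) + scalar cs (LaurentPolynomial.T 1) -
      scalar cs (LaurentPolynomial.T (-1))) * δ cs (cs.simple i) = 1 := by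
  have h := δ_simple_mul_inv cs i
  simp only [add_mul, sub_mul, mul_sub, mul_add] at h ⊢
  rw [scalar_comm, scalar_comm, h]

theorem isUnit_δ_simple (i : B) : IsUnit (δ cs (cs.simple i)) :=
  ⟨⟨_, _, δ_simple_mul_inv cs i, δ_simple_inv_mul cs i⟩, rfl⟩

theorem isUnit_δ (x : W) : IsUnit (δ cs x) := by
  induction h : cs.length x using Nat.strong_induction_on generalizing x with
  | _ n ih =>
    by_cases hx : x = 1
    · rw [hx, δ_one]; exact isUnit_one
    · obtain ⟨i, hi⟩ := cs.exists_rightDescent_of_ne_one hx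
      have hi' := (cs.isRightDescent_iff).1 hi
      have key : δ cs (x * cs.simple i) * δ cs (cs.simple i) = δ cs x := by
        rw [δ_mul, cs.simple_mul_simple_cancel_right]
        rw [cs.simple_mul_simple_cancel_right, cs.length_simple, hi']
      rw [← key]
      exact (ih _ (by omega) _ rfl).mul (isUnit_δ_simple cs i)

/-- The unit `δ_x` of the Hecke algebra. -/
def δUnit (x : W) : (Hecke cs)ˣ := (isUnit_δ cs x).unit

theorem δUnit_mul (x y : W) (h : cs.length x + cs.length y = cs.length (x * y)) :
    δUnit cs x * δUnit cs y = δUnit cs (x * y) := by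
  ext; simpa [δUnit] using δ_mul cs x y h

theorem δUnit_one : δUnit cs 1 = 1 := by
  ext; simpa [δUnit] using δ_one cs

theorem δUnit_inv_simple (i : B) : (↑(δUnit cs (cs.simple i))⁻¹ : Hecke cs) =
    δ cs (cs.simple i) + scalar cs (LaurentPolynomial.T 1) -
      scalar cs (LaurentPolynomial.T (-1)) := by
  rw [Units.inv_eq_of_mul_eq_one_right]
  simpa [δUnit] using δ_simple_mul_inv cs i

/-- The Hecke algebra with scalars acting through `v ↦ v⁻¹`; only used to define `bar`. -/
def BarHecke : Type _ := Hecke cs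

instance : Ring (BarHecke cs) := inferInstanceAs (Ring (Hecke cs))

instance : Algebra ℤ[T;T⁻¹] (BarHecke cs) :=
  RingHom.toAlgebra'
    ((algebraMap ℤ[T;T⁻¹] (Hecke cs)).comp
      (LaurentPolynomial.invert (R := ℤ) : ℤ[T;T⁻¹] →+* ℤ[T;T⁻¹]))
    (fun _ x => Algebra.commutes (R := ℤ[T;T⁻¹]) (A := Hecke cs) _ x)

theorem barHecke_algebraMap (p : ℤ[T;T⁻¹]) :
    algebraMap ℤ[T;T⁻¹] (BarHecke cs) p = scalar cs (LaurentPolynomial.invert p) := rfl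

/-- `δ_{x⁻¹}⁻¹` as an element of the twisted algebra. -/
def barGen (x : W) : BarHecke cs := (↑(δUnit cs x⁻¹)⁻¹ : Hecke cs)

theorem barGen_rel (p q : FreeAlgebra ℤ[T;T⁻¹] W) (h : HeckeRel cs p q) :
    FreeAlgebra.lift ℤ[T;T⁻¹] (barGen cs) p = FreeAlgebra.lift ℤ[T;T⁻¹] (barGen cs) q := by
  induction h with
  | one =>
    rw [FreeAlgebra.lift_ι_apply, map_one, barGen, inv_one, δUnit_one, inv_one]; rfl
  | mul x y h =>
    rw [map_mul, FreeAlgebra.lift_ι_apply, FreeAlgebra.lift_ι_apply, FreeAlgebra.lift_ι_apply]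
    unfold barGen
    rw [mul_inv_rev, ← δUnit_mul, mul_inv_rev]
    · exact (Units.val_mul _ _).symm
    · rw [← mul_inv_rev]; simp only [cs.length_inv]; omega
  | quad i =>
    rw [map_mul, map_add, map_sub, FreeAlgebra.lift_ι_apply, AlgHom.commutes, AlgHom.commutes,
      map_zero, barHecke_algebraMap, barHecke_algebraMap,
      LaurentPolynomial.invert_T, LaurentPolynomial.invert_T, neg_neg]
    unfold barGen
    rw [cs.inv_simple, δUnit_inv_simple]
    have h := δ_quad cs i
    change ((δ cs (cs.simple i) + scalar cs (LaurentPolynomial.T 1) -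
      scalar cs (LaurentPolynomial.T (-1)) + scalar cs (LaurentPolynomial.T (-1))) *
      (δ cs (cs.simple i) + scalar cs (LaurentPolynomial.T 1) -
      scalar cs (LaurentPolynomial.T (-1)) - scalar cs (LaurentPolynomial.T 1)) :
        Hecke cs) = 0
    rw [← h]
    congr 1 <;> abel

/-- `bar` as an algebra homomorphism to the twisted algebra. -/
def barAlg : Hecke cs →ₐ[ℤ[T;T⁻¹]] BarHecke cs := heckeLift cs (barGen cs) (barGen_rel cs)

/-- The Kazhdan–Lusztig involution of `H`: the ring homomorphism with `v ↦ v⁻¹` and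
`δ_x ↦ (δ_{x⁻¹})⁻¹`. -/
def bar : Hecke cs →+* Hecke cs := (barAlg cs).toRingHom

theorem bar_δ (x : W) : bar cs (δ cs x) = (↑(δUnit cs x⁻¹)⁻¹ : Hecke cs) :=
  heckeLift_δ cs _ (barGen_rel cs) x

theorem bar_scalar (p : ℤ[T;T⁻¹]) :
    bar cs (scalar cs p) = scalar cs (LaurentPolynomial.invert p) :=
  (barAlg cs).commutes p

theorem bar_δ_simple (i : B) : bar cs (δ cs (cs.simple i)) =
    δ cs (cs.simple i) + scalar cs (LaurentPolynomial.T 1) -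
      scalar cs (LaurentPolynomial.T (-1)) := by
  rw [bar_δ, cs.inv_simple, δUnit_inv_simple]

/-- The Kazhdan–Lusztig element `b_s = δ_s + v` of a simple reflection `s`. -/
def b (i : B) : Hecke cs := δ cs (cs.simple i) + scalar cs (LaurentPolynomial.T 1)

theorem bar_b (i : B) : bar cs (b cs i) = b cs i := by
  rw [b, map_add, bar_δ_simple, bar_scalar, LaurentPolynomial.invert_T]; abel

/-- `b_{s₁} ⋯ b_{s_k}` for an expression `(s₁, …, s_k)`. -/
def bWord (ω : List B) : Hecke cs := (ω.map (b cs)).prod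

/-- The sign character `H → ℤ[v, v⁻¹]`, `δ_x ↦ (-v)^{ℓ(x)}`. -/
def sgn : Hecke cs →ₐ[ℤ[T;T⁻¹]] ℤ[T;T⁻¹] :=
  heckeLift cs (fun x => (-LaurentPolynomial.T 1) ^ cs.length x) (by
    intro p q h
    induction h with
    | one => simp
    | mul x y h => simp [← h, pow_add]
    | quad i => simp)

theorem sgn_δ (x : W) : sgn cs (δ cs x) = (-LaurentPolynomial.T 1) ^ cs.length x :=
  heckeLift_δ cs _ _ x

/-! ### The antispherical module -/

/-- The Hecke algebra `H_I ⊆ H` of the parabolic subgroup `W_I`. -/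
def parabolicHecke (I : Set B) : Subalgebra ℤ[T;T⁻¹] (Hecke cs) :=
  Algebra.adjoin ℤ[T;T⁻¹] ((fun i => δ cs (cs.simple i)) '' I)

/-- The right submodule of `H` generated by all `a - sgn(a)`, `a ∈ H_I`. -/
def antisphericalKer (I : Set B) : Submodule (Hecke cs)ᵐᵒᵖ (Hecke cs) :=
  Submodule.span _ ((fun a => a - scalar cs (sgn cs a)) '' (parabolicHecke cs I : Set (Hecke cs)))

/-- The antispherical module `ᴵN = sgn ⊗_{H_I} H`, a right `H`-module. As `sgn` has rank one,
the map `r ⊗ h ↦ r h` identifies the balanced tensor product with the quotient of `H` by the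
right submodule generated by the elements `a - sgn(a)`, `a ∈ H_I`. -/
abbrev Antisph (I : Set B) : Type _ := Hecke cs ⧸ antisphericalKer cs I

/-- The element `1 ⊗ h` of the antispherical module. -/
def oneTensor (I : Set B) (h : Hecke cs) : Antisph cs I := (antisphericalKer cs I).mkQ h

theorem sgn_bar (I : Set B) {a : Hecke cs} (ha : a ∈ parabolicHecke cs I) :
    bar cs a ∈ parabolicHecke cs I ∧
      sgn cs (bar cs a) = LaurentPolynomial.invert (sgn cs a) := by
  have hT (p : ℤ[T;T⁻¹]) : sgn cs (scalar cs p) = p := (sgn cs).commutes p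
  induction ha using Algebra.adjoin_induction with
  | mem x hx =>
    obtain ⟨i, hi, rfl⟩ := hx
    simp only [bar_δ_simple]
    refine ⟨sub_mem (add_mem (Algebra.subset_adjoin ⟨i, hi, rfl⟩) (algebraMap_mem _ _))
      (algebraMap_mem _ _), ?_⟩
    rw [map_sub, map_add, hT, hT, sgn_δ, cs.length_simple]
    simp
  | algebraMap r =>
    change bar cs (scalar cs r) ∈ _ ∧ sgn cs (bar cs (scalar cs r)) = _
    rw [bar_scalar]
    change _ ∧ _ = LaurentPolynomial.invert (sgn cs (scalar cs r))
    exact ⟨algebraMap_mem _ _, by rw [hT, hT]⟩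
  | add x y _ _ hx hy =>
    simp only [map_add, hx.2, hy.2]
    exact ⟨add_mem hx.1 hy.1, trivial⟩
  | mul x y _ _ hx hy =>
    simp only [map_mul, hx.2, hy.2]
    exact ⟨mul_mem hx.1 hy.1, trivial⟩

theorem bar_mem_antisphericalKer (I : Set B) {h : Hecke cs} (hh : h ∈ antisphericalKer cs I) :
    bar cs h ∈ antisphericalKer cs I := by
  induction hh using Submodule.span_induction with
  | mem x hx =>
    obtain ⟨a, ha, rfl⟩ := hx
    have := sgn_bar cs I ha
    apply Submodule.subset_span
    refine ⟨bar cs a, this.1, ?_⟩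
    simp only [this.2, map_sub, bar_scalar]
  | zero => rw [map_zero]; exact zero_mem _
  | add x y _ _ hx hy => rw [map_add]; exact add_mem hx hy
  | smul r x _ hx =>
    have : bar cs (r • x) = MulOpposite.op (bar cs r.unop) • bar cs x := by
      rw [← MulOpposite.op_unop r, op_smul_eq_mul, map_mul]; rfl
    rw [this]
    exact Submodule.smul_mem _ _ hx

/-- The involution of `ᴵN` induced by the Kazhdan–Lusztig involution: `1 ⊗ h ↦ 1 ⊗ bar h`. -/
def barN (I : Set B) : Antisph cs I →+ Antisph cs I :=
  QuotientAddGroup.map (antisphericalKer cs I).toAddSubgroup (antisphericalKer cs I).toAddSubgroup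
    (bar cs).toAddMonoidHom (fun _ hx => bar_mem_antisphericalKer cs I hx)

theorem barN_oneTensor (I : Set B) (h : Hecke cs) :
    barN cs I (oneTensor cs I h) = oneTensor cs I (bar cs h) := rfl

/-- The standard element `δ_x^I = 1 ⊗ δ_x`, for `x ∈ ᴵW`. -/
def δN (I : Set B) (x : MinCosetRep cs I) : Antisph cs I := oneTensor cs I (δ cs x.1)

/-- The defining properties of the Kazhdan–Lusztig basis of `ᴵN`: each `d x` is self-dual, and
lies in `δ_x^I + ∑_{y < x} v ℤ[v] δ_y^I`, with `y ∈ ᴵW` and `<` the Bruhat order. -/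
def IsKLBasis (I : Set B) (d : MinCosetRep cs I → Antisph cs I) : Prop :=
  ∀ x, barN cs I (d x) = d x ∧
    d x - δN cs I x ∈ AddSubgroup.closure
      {m | ∃ (y : MinCosetRep cs I) (k : ℕ), BruhatLT cs y.1 x.1 ∧ 1 ≤ k ∧
        m = oneTensor cs I (scalar cs (LaurentPolynomial.T k) * δ cs y.1)}

/-- The identity, as an element of `ᴵW`. -/
def idRep (I : Set B) : MinCosetRep cs I := ⟨1, fun u _ => by simp⟩

/-- The Bott–Samelson element `d_id · b_{s₁} ⋯ b_{s_k}` of the expression `(s₁, …, s_k)`, where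
`d` is the Kazhdan–Lusztig basis of `ᴵN`. -/
def bottSamelson (I : Set B) (d : MinCosetRep cs I → Antisph cs I) (ω : List B) : Antisph cs I :=
  d (idRep cs I) <• bWord cs ω

end Hecke

/-! ### Type `B_n / A_{n-1}` -/

section TypeB

/-- The Coxeter matrix of type `B_n`, with nodes labelled `0, 1, …, n-1` so that the double bond
joins `0` and `1`. -/
def typeB (n : ℕ) : CoxeterMatrix (Fin n) := (CoxeterMatrix.B n).reindex Fin.revPerm

theorem typeB_apply (n : ℕ) (i j : Fin n) : typeB n i j =
    if i = j then 1
    else if (i.1 = 0 ∧ j.1 = 1) ∨ (i.1 = 1 ∧ j.1 = 0) then 4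
    else if i.1 + 1 = j.1 ∨ j.1 + 1 = i.1 then 3 else 2 := by
  have h : typeB n i j = CoxeterMatrix.B n (Fin.rev i) (Fin.rev j) := rfl
  rw [h]
  simp only [CoxeterMatrix.B, Matrix.of_apply, Fin.rev_inj, Fin.val_rev]
  have := i.2; have := j.2
  split_ifs <;> first | rfl | (exfalso; omega)

/-- `I ⊆ S` of type `A_{n-1}`: all simple reflections but `s_0`. -/
def typeA (n : ℕ) : Set (Fin n) := {i | i.1 ≠ 0}

/-- The right action of `s_i` on sets `x` of positive integers: `s_0` adds or removes `1`, and for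
`i > 0` the elements `i` and `i+1` are exchanged. -/
def step (i : ℕ) (x : Finset ℕ) : Finset ℕ :=
  if i = 0 then (if 1 ∈ x then x.erase 1 else insert 1 x)
  else if i ∈ x ∧ i + 1 ∉ x then insert (i + 1) (x.erase i)
  else if i + 1 ∈ x ∧ i ∉ x then insert i (x.erase (i + 1))
  else x

theorem mem_step_zero (x : Finset ℕ) (k : ℕ) :
    k ∈ step 0 x ↔ if k = 1 then 1 ∉ x else k ∈ x := by
  unfold step; split_ifs <;> simp_all

theorem mem_step_pos {i : ℕ} (hi : i ≠ 0) (x : Finset ℕ) (k : ℕ) :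
    k ∈ step i x ↔ Equiv.swap i (i + 1) k ∈ x := by
  unfold step
  rw [if_neg hi, Equiv.swap_apply_def]
  grind

theorem step_step (i : ℕ) (x : Finset ℕ) : step i (step i x) = x := by
  ext k
  rcases eq_or_ne i 0 with rfl | hi
  · simp only [mem_step_zero]; split_ifs <;> simp_all
  · simp only [mem_step_pos hi, Equiv.swap_apply_self]

/-- `s_i` as a permutation of the finite sets of positive integers. -/
def stepPerm (i : ℕ) : Equiv.Perm (Finset ℕ) := ⟨step i, step i, step_step i, step_step i⟩

theorem stepPerm_apply (i : ℕ) (x : Finset ℕ) : stepPerm i x = step i x := rfl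

theorem mem_step_zero_one (x : Finset ℕ) (k : ℕ) : k ∈ step 0 (step 1 x) ↔
    if k = 1 then 2 ∉ x else if k = 2 then 1 ∈ x else k ∈ x := by
  simp only [mem_step_zero, mem_step_pos one_ne_zero, Equiv.swap_apply_def]
  grind

theorem mem_step_one_zero (x : Finset ℕ) (k : ℕ) : k ∈ step 1 (step 0 x) ↔
    if k = 1 then 2 ∈ x else if k = 2 then 1 ∉ x else k ∈ x := by
  simp only [mem_step_zero, mem_step_pos one_ne_zero, Equiv.swap_apply_def]
  grind

theorem step_braid {i : ℕ} (hi : i ≠ 0) (x : Finset ℕ) :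
    step i (step (i + 1) (step i x)) = step (i + 1) (step i (step (i + 1) x)) := by
  ext k
  simp only [mem_step_pos hi, mem_step_pos i.succ_ne_zero]
  have h : Equiv.swap i (i + 1) (Equiv.swap (i + 1) (i + 1 + 1) (Equiv.swap i (i + 1) k)) =
      Equiv.swap (i + 1) (i + 1 + 1) (Equiv.swap i (i + 1)
        (Equiv.swap (i + 1) (i + 1 + 1) k)) := by
    simp only [Equiv.swap_apply_def]; grind
  rw [h]

theorem step_comm {i j : ℕ} (h1 : i + 1 ≠ j) (h2 : j + 1 ≠ i) (h3 : i ≠ j) (x : Finset ℕ) :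
    step i (step j x) = step j (step i x) := by
  ext k
  rcases eq_or_ne i 0 with rfl | hi
  · simp only [mem_step_zero, mem_step_pos h3.symm, Equiv.swap_apply_def]; grind
  · rcases eq_or_ne j 0 with rfl | hj
    · simp only [mem_step_zero, mem_step_pos hi, Equiv.swap_apply_def]; grind
    · have h : Equiv.swap j (j + 1) (Equiv.swap i (i + 1) k) =
          Equiv.swap i (i + 1) (Equiv.swap j (j + 1) k) := by
        simp only [Equiv.swap_apply_def]; grind
      simp only [mem_step_pos hi, mem_step_pos hj, h]

theorem step_liftable (n : ℕ) : (typeB n).IsLiftable fun i => stepPerm i.1 := by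
  intro i j
  rw [typeB_apply]
  split_ifs with h1 h2 h3
  · subst h1; ext1 x; simp [Equiv.Perm.mul_apply, stepPerm_apply, step_step]
  · ext x k
    rcases h2 with ⟨hi, hj⟩ | ⟨hi, hj⟩
    · simp only [hi, hj, pow_succ, pow_zero, one_mul, Equiv.Perm.mul_apply, stepPerm_apply,
        mem_step_zero_one, Equiv.Perm.one_apply]
      grind
    · simp only [hi, hj, pow_succ, pow_zero, one_mul, Equiv.Perm.mul_apply, stepPerm_apply,
        mem_step_one_zero, Equiv.Perm.one_apply]
      grind
  · have hi : i.1 ≠ 0 := by omega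
    have hj : j.1 ≠ 0 := by omega
    ext1 x
    simp only [pow_succ, pow_zero, one_mul, Equiv.Perm.mul_apply, stepPerm_apply,
      Equiv.Perm.one_apply]
    rcases h3 with h3 | h3
    · rw [← h3, ← step_braid hi (step _ (step _ x)), step_step, step_step, step_step]
    · rw [← h3, step_braid hj (step _ (step _ x)), step_step, step_step, step_step]
  · have hij : i.1 ≠ j.1 := fun h => h1 (Fin.ext h)
    ext1 x
    simp only [pow_succ, pow_zero, one_mul, Equiv.Perm.mul_apply, stepPerm_apply,
      Equiv.Perm.one_apply]
    rw [step_comm (i := i.1) (j := j.1) (by omega) (by omega) hij, step_step, step_step]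

variable {n : ℕ} {W : Type*} [Group W] (cs : CoxeterSystem (typeB n) W)

/-- The subset of `{1, …, n}` attached to `w = s_{i₁} ⋯ s_{i_k}`: apply `s_{i₁}`, then `s_{i₂}`,
and so on, to `∅`. It identifies `ᴵW` with the set of subsets of `{1, …, n}`. -/
def subsetOf (w : W) : Finset ℕ := cs.lift ⟨fun i => stepPerm i.1, step_liftable n⟩ w⁻¹ ∅

theorem subsetOf_one : subsetOf cs 1 = ∅ := by simp [subsetOf]

theorem subsetOf_mul_simple (w : W) (i : Fin n) :
    subsetOf cs (w * cs.simple i) = step i.1 (subsetOf cs w) := by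
  rw [subsetOf, mul_inv_rev, cs.inv_simple, map_mul, Equiv.Perm.mul_apply,
    cs.lift_apply_simple (step_liftable n)]
  rfl

theorem subsetOf_wordProd (w : W) (ω : List (Fin n)) :
    subsetOf cs (w * cs.wordProd ω) = ω.foldl (fun x i => step i.1 x) (subsetOf cs w) := by
  induction ω generalizing w with
  | nil => simp
  | cons i ω ih => rw [cs.wordProd_cons, ← mul_assoc, ih, subsetOf_mul_simple]; rfl

theorem sum_step_le (i : ℕ) (x : Finset ℕ) : ∑ t ∈ step i x, t ≤ ∑ t ∈ x, t + 1 := by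
  unfold step
  split_ifs with h0 h1 h2 h3
  · have := Finset.add_sum_erase x id h1
    simp only [id] at this; omega
  · rw [Finset.sum_insert h1]; omega
  · have := Finset.add_sum_erase x id h2.1
    rw [Finset.sum_insert (by simp [h2.2])]
    simp only [id] at this; omega
  · have := Finset.add_sum_erase x id h3.1
    rw [Finset.sum_insert (by simp [h3.2])]
    simp only [id] at this; omega
  · omega

theorem sum_subsetOf_le (w : W) : ∑ t ∈ subsetOf cs w, t ≤ cs.length w := by
  obtain ⟨ω, hω, rfl⟩ := cs.exists_isReduced w
  rw [hω.eq, ← one_mul (cs.wordProd ω), subsetOf_wordProd, subsetOf_one]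
  have key : ∀ (l : List (Fin n)) (x : Finset ℕ),
      ∑ t ∈ l.foldl (fun x i => step i.1 x) x, t ≤ ∑ t ∈ x, t + l.length := by
    intro l
    induction l with
    | nil => simp
    | cons i l ih =>
      intro x
      have := sum_step_le i.1 x
      have := ih (step i.1 x)
      simp only [List.foldl_cons, List.length_cons]; omega
  simpa using key ω ∅

theorem subsetOf_parabolic_mul {u : W} (hu : u ∈ parabolic cs (typeA n)) (w : W) :
    subsetOf cs (u * w) = subsetOf cs w := by
  have key : cs.lift ⟨fun i => stepPerm i.1, step_liftable n⟩ u ∅ = ∅ := by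
    induction hu using Subgroup.closure_induction with
    | mem x hx =>
      obtain ⟨i, hi, rfl⟩ := hx
      rw [cs.lift_apply_simple (step_liftable n), stepPerm_apply]
      ext k
      have hi' : i.1 ≠ 0 := hi
      simp [mem_step_pos hi']
    | one => simp
    | mul x y _ _ hx hy => rw [map_mul, Equiv.Perm.mul_apply, hy, hx]
    | inv x _ hx => rw [map_inv, Equiv.Perm.inv_eq_iff_eq, hx]
  rw [subsetOf, subsetOf, mul_inv_rev, map_mul, Equiv.Perm.mul_apply, map_inv _ u]
  congr 1
  rw [Equiv.Perm.inv_eq_iff_eq, key]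

/-- The row `s_0 s_1 ⋯ s_{t-1}`, for `t ≤ n`. -/
def row (n t : ℕ) : List (Fin n) :=
  (List.range t).filterMap fun i => if h : i < n then some ⟨i, h⟩ else none

/-- The row reduced expression of `x = {t_1 > ⋯ > t_l} ⊆ {1, …, n}`: the concatenation of the
rows of `t_1, …, t_l`. -/
def rowExpr (n : ℕ) (x : Finset ℕ) : List (Fin n) := (x.sort (· ≥ ·)).flatMap (row n)

theorem foldl_row {t : ℕ} (ht : t ≤ n) (x : Finset ℕ) (hx : ∀ a ∈ x, t < a) :
    (row n t).foldl (fun x i => step i.1 x) x = if t = 0 then x else insert t x := by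
  induction t with
  | zero => simp [row]
  | succ t ih =>
    have e : row n (t + 1) = row n t ++ [⟨t, ht⟩] := by
      simp [row, List.range_succ, List.filterMap_append, Nat.lt_of_succ_le ht]
    rw [e, List.foldl_append, ih (by omega) (fun a ha => by have := hx a ha; omega)]
    have h1 : t ∉ x := fun h => by have := hx _ h; omega
    have h2 : t + 1 ∉ x := fun h => by have := hx _ h; omega
    rcases Nat.eq_zero_or_pos t with rfl | h0
    · simp only [List.foldl_cons, List.foldl_nil]
      ext k; simp only [if_true, mem_step_zero]; grind
    · simp only [List.foldl_cons, List.foldl_nil]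
      ext k; rw [mem_step_pos (by omega), Equiv.swap_apply_def]; grind

theorem foldl_rows (l : List ℕ) (hl : l.Pairwise (· > ·)) (hn : ∀ t ∈ l, 1 ≤ t ∧ t ≤ n)
    (x : Finset ℕ) (hx : ∀ a ∈ x, ∀ t ∈ l, t < a) :
    (l.flatMap (row n)).foldl (fun x i => step i.1 x) x = x ∪ l.toFinset := by
  induction l generalizing x with
  | nil => simp
  | cons t l ih =>
    have ht := hn t (by simp)
    rw [List.pairwise_cons] at hl
    rw [List.flatMap_cons, List.foldl_append, foldl_row ht.2 x (fun a ha => hx a ha t (by simp)),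
      if_neg (by omega), ih hl.2 (fun s hs => hn s (by simp [hs]))]
    · ext k; simp
    · intro a ha s hs
      rcases Finset.mem_insert.1 ha with rfl | ha
      · exact hl.1 s hs
      · exact hx a ha s (by simp [hs])

theorem subsetOf_rowExpr {x : Finset ℕ} (hx : x ⊆ Finset.Icc 1 n) :
    subsetOf cs (cs.wordProd (rowExpr n x)) = x := by
  rw [← one_mul (cs.wordProd _), subsetOf_wordProd, subsetOf_one, rowExpr, foldl_rows]
  · simp
  · exact (Finset.sortedGT_sort x).pairwise
  · intro t ht; simpa using hx ((Finset.mem_sort _).1 ht)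
  · simp

theorem length_rowExpr_le (n : ℕ) (x : Finset ℕ) : (rowExpr n x).length ≤ ∑ t ∈ x, t := by
  have h1 (t : ℕ) : (row n t).length ≤ t := by
    rw [row]
    refine (?_ : _ ≤ (List.range t).length).trans (List.length_range).le
    exact List.length_filterMap_le (fun i => if h : i < n then some (⟨i, h⟩ : Fin n)
      else none) (List.range t)
  have h2 (l : List ℕ) : (l.flatMap (row n)).length ≤ l.sum := by
    induction l with
    | nil => simp
    | cons t l ih => have := h1 t; simp only [List.flatMap_cons, List.length_append,
        List.sum_cons]; omega
  refine (h2 _).trans (le_of_eq ?_)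
  rw [← Multiset.sum_coe, Finset.sort_eq, Finset.sum_eq_multiset_sum, Multiset.map_id']

/-- The element of `ᴵW` corresponding to a subset `x` of `{1, …, n}` (elements of `x` outside
`{1, …, n}` are discarded). -/
def ofSubset (x : Finset ℕ) : MinCosetRep cs (typeA n) :=
  ⟨cs.wordProd (rowExpr n (x ∩ Finset.Icc 1 n)), fun u hu => by
    have h1 := sum_subsetOf_le cs (u * cs.wordProd (rowExpr n (x ∩ Finset.Icc 1 n)))
    rw [subsetOf_parabolic_mul cs hu, subsetOf_rowExpr cs Finset.inter_subset_right] at h1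
    exact (cs.length_wordProd_le _).trans ((length_rowExpr_le n _).trans h1)⟩

theorem subsetOf_ofSubset {x : Finset ℕ} (hx : x ⊆ Finset.Icc 1 n) :
    subsetOf cs (ofSubset cs x).1 = x := by
  have h : x ∩ Finset.Icc 1 n = x := Finset.inter_eq_left.2 hx
  simp only [ofSubset, h, subsetOf_rowExpr cs hx]

/-- The condition on `t ∈ x` to lie in `E(x)`: `t` is even and, for all `1 ≤ k < t`, the interval
`{k, …, t}` contains more elements of `x` than elements outside `x`. -/
def InDefectSet (x : Finset ℕ) (t : ℕ) : Prop :=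
  Even t ∧ ∀ k ∈ Finset.Ico 1 t, (Finset.Icc k t \ x).card < (Finset.Icc k t ∩ x).card

instance (x : Finset ℕ) (t : ℕ) : Decidable (InDefectSet x t) :=
  inferInstanceAs (Decidable (_ ∧ _))

/-- The set `E(x) ⊆ x`. -/
def defectSet (x : Finset ℕ) : Finset ℕ := x.filter (InDefectSet x)

end TypeB

end Antispherical

end

/-! Encode a subset of {1, …, n} as a square-free monomial in X_1, …, X_n, so that standard elements
become monomials. For i ≥ 1 the element b_{s_i} touches only X_i and X_{i+1}: 1 ↦ 0, X_i X_{i+1} ↦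
0, X_i ↦ X_{i+1} + v X_i, X_{i+1} ↦ X_i + v⁻¹ X_{i+1}. The element b_{s_0} touches only X_1: 1 ↦ X_1
+ v, X_1 ↦ 1 + v⁻¹ X_1.

Read the positions 1, …, n as parentheses, opening if outside x and closing if in x, and match them.
Attach X_p + v X_c to a matched pair c < p, and X_p + 1 or X_p + v to an unmatched p ∈ x that is
even or odd. The product of these factors is the Bott–Samelson element of x (`stdElt_smul_bWord`):
every letter of a reduced expression raises the subset, and the local rules turn the product of a
subset into that of the next one (`act_cupProd`).

The unmatched elements of x alternate in parity, the first being odd, and E(x) consists of the even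
ones. If an even p is followed by the unmatched element p', then (X_p + 1)(X_{p'} + v) = (X_p X_{p'}
+ v) + (X_{p'} + v X_p), and the last summand is the factor of the pair p < p' that arises when p is
removed from x. A last even p contributes X_p + 1, with 1 for its removal. Expanding all even
factors gives a sum over E ⊆ E(x) of products `klProd (x \ E)` (`cupProd_eq_sum`).

These products represent the Kazhdan–Lusztig basis. Each factor is a monomial, possibly plus v times
the monomial of a lower set, which yields triangularity (`isTriangular_klProd`). Bott–Samelson
elements are self-dual, so the products are self-dual by induction on |x| (`barN_klElt`).

Uniqueness needs independence of the standard elements. As H is given by generators and relations,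
this is extracted from its regular representation on the free module on W, whose construction rests
on the exchange condition (`leftOp_rightOp_comm`), followed by a map to the free module on ᴵW that
is compatible with sgn (`coord_δN`). Then a self-dual element with coefficients in vℤ[v] vanishes
(`eq_zero_of_barN_eq`). -/

open scoped LaurentPolynomial RightActions

noncomputable section

namespace Antispherical

/-! ### The exchange condition, through the signed action on reflections -/

section Exchange

open CoxeterSystem

variable {B : Type*} {M : CoxeterMatrix B} {W : Type*} [Group W] (cs : CoxeterSystem M W)

open Classical in
/-- The simple reflection `s_i` acting on `W × ZMod 2` by conjugation, changing the sign of `s_i`. -/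
def signedConj (i : B) : Function.End (W × ZMod 2) := fun p =>
  (cs.simple i * p.1 * cs.simple i, p.2 + if p.1 = cs.simple i then 1 else 0)

open Classical in
-- The sign flips at a letter exactly when conjugation by the letters to its right has carried r to
-- that simple reflection, that is, when r is the entry of the right inversion sequence at that
-- letter.
theorem signedConj_word (ω : List B) (r : W) (ε : ZMod 2) :
    (ω.map (signedConj cs)).prod (r, ε) =
      (cs.wordProd ω * r * (cs.wordProd ω)⁻¹, ε + ((cs.rightInvSeq ω).count r : ℕ)) := by
  induction ω with
  | nil => simp [Function.End.one_def]
  | cons i ω ih =>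
    have h : ((i :: ω).map (signedConj cs)).prod (r, ε) =
      signedConj cs i ((ω.map (signedConj cs)).prod (r, ε)) := by
      rw [List.map_cons, List.prod_cons]; rfl
    rw [h, ih, signedConj, cs.wordProd_cons]
    have h2 : cs.rightInvSeq (i :: ω) =
      ((cs.wordProd ω)⁻¹ * cs.simple i * cs.wordProd ω) :: cs.rightInvSeq ω := rfl
    rw [h2, List.count_cons]
    have h3 : (cs.wordProd ω * r * (cs.wordProd ω)⁻¹ = cs.simple i) ↔
        ((cs.wordProd ω)⁻¹ * cs.simple i * cs.wordProd ω = r) := by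
      constructor
      · intro h; rw [← h]; group
      · intro h; rw [← h]; group
    refine Prod.ext ?_ ?_
    · simp [mul_assoc]
    · simp only [h3, beq_iff_eq]
      split_ifs <;> push_cast <;> ring

open Classical in
-- By (s_i s_j)^m = 1 the left inversion sequence of the alternating word of length 2m has period m,
-- so its two halves agree.
theorem even_count_leftInvSeq (i j : B) (r : W) :
    Even ((cs.leftInvSeq (alternatingWord i j (2 * M i j))).count r) := by
  set L := cs.leftInvSeq (alternatingWord i j (2 * M i j)) with hL
  have hlen : L.length = 2 * M i j := by simp [hL]
  have h : L.drop (M i j) = L.take (M i j) := by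
    refine List.ext_getElem (by simp [hlen]; omega) fun k h1 h2 => ?_
    have hk : k < M i j := by simp [hlen] at h1; omega
    rw [List.getElem_drop, List.getElem_take]
    simp only [hL]
    rw [cs.getElem_leftInvSeq_alternatingWord _ _ _ _ (by omega),
      cs.getElem_leftInvSeq_alternatingWord _ _ _ _ (by omega),
      cs.prod_alternatingWord_eq_mul_pow, cs.prod_alternatingWord_eq_mul_pow]
    have e1 : (2 * (M i j + k) + 1) / 2 = M i j + k := by omega
    have e2 : (2 * k + 1) / 2 = k := by omega
    rw [e1, e2, pow_add, cs.simple_mul_simple_pow', one_mul]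
    simp
  rw [← List.take_append_drop (M i j) L, List.count_append, h]
  exact ⟨_, rfl⟩

theorem signedConj_liftable : M.IsLiftable (signedConj cs) := by
  classical
  intro i j
  have h : ∀ m : ℕ, (signedConj cs i * signedConj cs j) ^ m =
      ((alternatingWord j i (2 * m)).reverse.map (signedConj cs)).prod := by
    intro m
    induction m with
    | zero => simp [alternatingWord]
    | succ m ih =>
      have e : alternatingWord j i (2 * (m + 1)) = j :: i :: alternatingWord j i (2 * m) := by
        rw [show 2 * (m + 1) = 2 * m + 1 + 1 by ring, alternatingWord_succ', alternatingWord_succ']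
        simp
      rw [e, pow_succ, ih]
      simp
  rw [h]
  funext ⟨r, ε⟩
  rw [signedConj_word, cs.rightInvSeq_reverse, List.count_reverse, cs.wordProd_reverse,
    cs.prod_alternatingWord_eq_mul_pow, M.symmetric i j]
  have h2 := even_count_leftInvSeq cs j i r
  rw [M.symmetric j i] at h2 ⊢
  rw [(ZMod.natCast_eq_zero_iff_even).2 h2]
  simp [Function.End.one_def]

open Classical in
-- The signed action satisfies the Coxeter relations, so it depends only on the group element; the
-- parity of the number of occurrences of r is its sign part.
theorem count_rightInvSeq_eq {ω ω' : List B} (h : cs.wordProd ω = cs.wordProd ω') (r : W) :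
    ((cs.rightInvSeq ω).count r : ZMod 2) = ((cs.rightInvSeq ω').count r : ℕ) := by
  have key (ω : List B) : (ω.map (signedConj cs)).prod =
      cs.lift ⟨_, signedConj_liftable cs⟩ (cs.wordProd ω) := by
    rw [wordProd, map_list_prod, List.map_map]
    congr 2
    funext i
    exact (cs.lift_apply_simple (signedConj_liftable cs) i).symm
  have h1 : (ω.map (signedConj cs)).prod (r, 0) = (ω'.map (signedConj cs)).prod (r, 0) := by
    rw [key, key, h]
  rw [signedConj_word, signedConj_word] at h1
  simpa using congrArg Prod.snd h1

/-- A simple right descent of a word's product occurs in the right inversion sequence. -/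
theorem simple_mem_rightInvSeq {ω : List B} {i : B} (h : cs.IsRightDescent (cs.wordProd ω) i) :
    cs.simple i ∈ cs.rightInvSeq ω := by
  classical
  -- A reduced word of the same element that ends in `i` has `s_i` exactly once in its inversion
  -- sequence. By invariance of the parity, `s_i` occurs an odd number of times for `ω`.
  obtain ⟨ω', hω', h1⟩ := cs.exists_isReduced (cs.wordProd ω * cs.simple i)
  have h2 : cs.wordProd (ω'.concat i) = cs.wordProd ω := by
    rw [cs.wordProd_concat, ← h1, cs.simple_mul_simple_cancel_right]
  have h3 : cs.IsReduced (ω'.concat i) := by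
    rw [CoxeterSystem.IsReduced, h2, List.length_concat, ← hω'.eq, ← h1]
    exact ((cs.isRightDescent_iff).1 h).symm
  have h4 : (cs.rightInvSeq (ω'.concat i)).count (cs.simple i) = 1 :=
    List.count_eq_one_of_mem h3.nodup_rightInvSeq (by rw [cs.rightInvSeq_concat]; simp)
  have h5 := count_rightInvSeq_eq cs h2 (cs.simple i)
  rw [h4] at h5
  refine List.count_pos_iff.1 (Nat.pos_of_ne_zero fun h0 => ?_)
  rw [h0] at h5
  exact absurd h5 (by decide)

/-- For a reduced word ω of w, s_j occurs in the right inversion sequence of i :: ω. It is not in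
the tail, since j is no descent of w, so it is the head w⁻¹ s_i w. -/
theorem simple_mul_eq_mul_simple {w : W} {i j : B} (hi : ¬ cs.IsLeftDescent w i)
    (hj : ¬ cs.IsRightDescent w j) (hij : cs.IsRightDescent (cs.simple i * w) j) :
    cs.simple i * w = w * cs.simple j := by
  obtain ⟨ω, hω, rfl⟩ := cs.exists_isReduced w
  rw [← cs.wordProd_cons] at hij
  have h := simple_mem_rightInvSeq cs hij
  have h2 : cs.rightInvSeq (i :: ω) =
      ((cs.wordProd ω)⁻¹ * cs.simple i * cs.wordProd ω) :: cs.rightInvSeq ω := rfl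
  rw [h2, List.mem_cons] at h
  rcases h with h | h
  · rw [h]; group
  · exact absurd (cs.isRightInversion_of_mem_rightInvSeq hω h).2 hj

/-- If left multiplication by s_i changed the descent status of j, then `simple_mul_eq_mul_simple`,
applied to w or to s_i w, would force s_i w = w s_j. -/
theorem isRightDescent_simple_mul_iff {w : W} {i j : B}
    (h : cs.simple i * w ≠ w * cs.simple j) :
    cs.IsRightDescent (cs.simple i * w) j ↔ cs.IsRightDescent w j := by
  have e1 := cs.length_simple_mul w i
  have e2 := cs.length_simple_mul (w * cs.simple j) i
  have e3 := cs.length_mul_simple w j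
  have e4 := cs.length_mul_simple (cs.simple i * w) j
  have A := fun h1 h2 h3 => h (simple_mul_eq_mul_simple cs (w := w) (i := i) (j := j) h1 h2 h3)
  have B := simple_mul_eq_mul_simple cs (w := cs.simple i * w) (i := i) (j := j)
  rw [cs.simple_mul_simple_cancel_left] at B
  have B' := fun h1 h2 h3 => h (by
    have := congrArg (cs.simple i * ·) (B h1 h2 h3)
    simp only [← mul_assoc, cs.simple_mul_simple_self, one_mul] at this
    exact this)
  unfold IsRightDescent IsLeftDescent at *
  rw [cs.simple_mul_simple_cancel_left] at B'
  rw [← mul_assoc] at e2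
  constructor
  · intro h1
    by_contra h2
    by_cases h3 : cs.length (cs.simple i * w) < cs.length w
    · omega
    · exact A h3 h2 h1
  · intro h1
    by_contra h2
    by_cases h3 : cs.length (cs.simple i * w) < cs.length w
    · exact B' (by omega) h2 h1
    · omega

theorem isLeftDescent_mul_simple_iff {w : W} {i j : B}
    (h : cs.simple i * w ≠ w * cs.simple j) :
    cs.IsLeftDescent (w * cs.simple j) i ↔ cs.IsLeftDescent w i := by
  rw [← cs.isRightDescent_inv_iff, ← cs.isRightDescent_inv_iff, mul_inv_rev, cs.inv_simple]
  apply isRightDescent_simple_mul_iff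
  intro h'
  apply h
  have := congrArg (·⁻¹) h'
  simpa using this.symm

end Exchange

/-! ### The regular representation of the Hecke algebra -/

section Regular

open CoxeterSystem LaurentPolynomial

variable {B : Type*} {M : CoxeterMatrix B} {W : Type*} [Group W] (cs : CoxeterSystem M W)

open Classical in
/-- Left multiplication by `δ_{s_i}` on the free module on `W`. -/
def leftOp (i : B) : Module.End ℤ[T;T⁻¹] (W →₀ ℤ[T;T⁻¹]) :=
  Finsupp.linearCombination ℤ[T;T⁻¹] fun w => Finsupp.single (cs.simple i * w) 1 +
    if cs.IsLeftDescent w i then (T (-1) - T 1 : ℤ[T;T⁻¹]) • Finsupp.single w 1 else 0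

open Classical in
/-- Right multiplication by `δ_{s_i}` on the free module on `W`. -/
def rightOp (i : B) : Module.End ℤ[T;T⁻¹] (W →₀ ℤ[T;T⁻¹]) :=
  Finsupp.linearCombination ℤ[T;T⁻¹] fun w => Finsupp.single (w * cs.simple i) 1 +
    if cs.IsRightDescent w i then (T (-1) - T 1 : ℤ[T;T⁻¹]) • Finsupp.single w 1 else 0

open Classical in
theorem leftOp_single (i : B) (w : W) : leftOp cs i (Finsupp.single w 1) =
    Finsupp.single (cs.simple i * w) 1 +
    if cs.IsLeftDescent w i then (T (-1) - T 1 : ℤ[T;T⁻¹]) • Finsupp.single w 1 else 0 := by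
  simp only [leftOp, Finsupp.linearCombination_single, one_smul]

open Classical in
theorem rightOp_single (i : B) (w : W) : rightOp cs i (Finsupp.single w 1) =
    Finsupp.single (w * cs.simple i) 1 +
    if cs.IsRightDescent w i then (T (-1) - T 1 : ℤ[T;T⁻¹]) • Finsupp.single w 1 else 0 := by
  simp only [rightOp, Finsupp.linearCombination_single, one_smul]

/-- If s_i w = w s_j, the left and right descent conditions on w agree, as do those on w s_j.
Otherwise multiplication on one side does not affect descents on the other side. -/
theorem leftOp_rightOp_comm (i j : B) :
    leftOp cs i * rightOp cs j = rightOp cs j * leftOp cs i := by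
  classical
  refine Finsupp.lhom_ext' fun w => LinearMap.ext_ring ?_
  simp only [LinearMap.comp_apply, Finsupp.lsingle_apply, Module.End.mul_apply, leftOp_single,
    rightOp_single, map_add, apply_ite (leftOp cs i), apply_ite (rightOp cs j), map_smul, map_zero]
  by_cases h : cs.simple i * w = w * cs.simple j
  · have e1 : cs.simple i * (w * cs.simple j) = w := by
      rw [← h, cs.simple_mul_simple_cancel_left]
    have e2 : cs.IsLeftDescent (w * cs.simple j) i ↔ cs.IsRightDescent (w * cs.simple j) j := by
      rw [IsLeftDescent, IsRightDescent, e1, cs.simple_mul_simple_cancel_right]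
    have e3 : cs.IsLeftDescent w i ↔ cs.IsRightDescent w j := by
      rw [IsLeftDescent, IsRightDescent, h]
    rw [h, e1, cs.simple_mul_simple_cancel_right, if_congr e2 rfl rfl]
    by_cases h3 : cs.IsRightDescent w j
    · simp only [if_pos h3, if_pos (e3.2 h3)]
    · simp only [if_neg h3, if_neg (fun h => h3 (e3.1 h))]
  · rw [if_congr (isLeftDescent_mul_simple_iff cs h) rfl rfl,
      if_congr (isRightDescent_simple_mul_iff cs h) rfl rfl, mul_assoc]
    split_ifs <;> module

theorem leftOp_word_single_one {ω : List B} (h : cs.IsReduced ω) :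
    (ω.map (leftOp cs)).prod (Finsupp.single 1 1) = Finsupp.single (cs.wordProd ω) 1 := by
  classical
  induction ω with
  | nil => simp
  | cons i ω ih =>
    have h1 : cs.IsReduced ω := by simpa using h.drop 1
    rw [List.map_cons, List.prod_cons, Module.End.mul_apply, ih h1, leftOp_single,
      ← cs.wordProd_cons, if_neg, add_zero]
    rw [IsLeftDescent, ← cs.wordProd_cons, h.eq, h1.eq]
    simp

theorem rightOp_word_single_one {ω : List B} (h : cs.IsReduced ω) :
    (ω.reverse.map (rightOp cs)).prod (Finsupp.single 1 1) =
      Finsupp.single (cs.wordProd ω) 1 := by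
  classical
  induction ω using List.reverseRecOn with
  | nil => simp
  | append_singleton ω i ih =>
    have h1 : cs.IsReduced ω := by simpa using h.take ω.length
    rw [List.reverse_append, List.reverse_singleton, List.singleton_append, List.map_cons,
      List.prod_cons, Module.End.mul_apply, ih h1, rightOp_single, ← List.concat_eq_append,
      cs.wordProd_concat, if_neg, add_zero]
    rw [IsRightDescent, ← cs.wordProd_concat, List.concat_eq_append, h.eq, h1.eq]
    simp

/-- The right operators move the basis vector 1 to every basis vector. An operator commuting with
them is thus determined by its value at 1, where identities between left operators are easy to
check. -/
theorem eq_of_commute_rightOp {F G : Module.End ℤ[T;T⁻¹] (W →₀ ℤ[T;T⁻¹])}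
    (hF : ∀ j, Commute F (rightOp cs j)) (hG : ∀ j, Commute G (rightOp cs j))
    (h : F (Finsupp.single 1 1) = G (Finsupp.single 1 1)) : F = G := by
  refine Finsupp.lhom_ext' fun w => LinearMap.ext_ring ?_
  obtain ⟨ω, hω, rfl⟩ := cs.exists_isReduced w
  have key {F : Module.End ℤ[T;T⁻¹] (W →₀ ℤ[T;T⁻¹])} (hF : ∀ j, Commute F (rightOp cs j)) :
      Commute F (ω.reverse.map (rightOp cs)).prod :=
    Commute.list_prod_right _ _ fun x hx => by
      obtain ⟨j, -, rfl⟩ := List.mem_map.1 hx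
      exact hF j
  simp only [LinearMap.comp_apply, Finsupp.lsingle_apply]
  rw [← rightOp_word_single_one cs hω, ← Module.End.mul_apply, ← Module.End.mul_apply,
    (key hF).eq, (key hG).eq, Module.End.mul_apply, Module.End.mul_apply, h]

theorem commute_leftOp_word (ω : List B) (j : B) :
    Commute (ω.map (leftOp cs)).prod (rightOp cs j) :=
  Commute.list_prod_left _ _ fun x hx => by
    obtain ⟨i, -, rfl⟩ := List.mem_map.1 hx
    exact leftOp_rightOp_comm cs i j

/-- Left multiplication by `δ_w` on the free module on `W`. -/
def leftMul (w : W) : Module.End ℤ[T;T⁻¹] (W →₀ ℤ[T;T⁻¹]) :=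
  ((cs.exists_isReduced w).choose.map (leftOp cs)).prod

theorem leftMul_single_one (w : W) : leftMul cs w (Finsupp.single 1 1) = Finsupp.single w 1 := by
  have h := (cs.exists_isReduced w).choose_spec
  rw [leftMul, leftOp_word_single_one cs h.1, ← h.2]

/-- Independence of the chosen reduced word, without Matsumoto's theorem: both operators commute
with the right operators and agree at 1. -/
theorem leftMul_eq {ω : List B} (h : cs.IsReduced ω) :
    leftMul cs (cs.wordProd ω) = (ω.map (leftOp cs)).prod :=
  eq_of_commute_rightOp cs (commute_leftOp_word cs _) (commute_leftOp_word cs _) (by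
    rw [leftMul_single_one, leftOp_word_single_one cs h])

theorem leftMul_simple (i : B) : leftMul cs (cs.simple i) = leftOp cs i := by
  have h := leftMul_eq cs (ω := [i]) (by simp [CoxeterSystem.IsReduced])
  simpa using h

theorem leftMul_mul (x y : W) (h : cs.length x + cs.length y = cs.length (x * y)) :
    leftMul cs x * leftMul cs y = leftMul cs (x * y) := by
  obtain ⟨ω, hω, rfl⟩ := cs.exists_isReduced x
  obtain ⟨ω', hω', rfl⟩ := cs.exists_isReduced y
  have h' : cs.IsReduced (ω ++ ω') := by
    rw [CoxeterSystem.IsReduced, cs.wordProd_append, ← h, hω.eq, hω'.eq, List.length_append]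
  rw [leftMul_eq cs hω, leftMul_eq cs hω', ← cs.wordProd_append, leftMul_eq cs h',
    List.map_append, List.prod_append]

theorem leftMul_rel (p q : FreeAlgebra ℤ[T;T⁻¹] W) (h : HeckeRel cs p q) :
    FreeAlgebra.lift ℤ[T;T⁻¹] (leftMul cs) p = FreeAlgebra.lift ℤ[T;T⁻¹] (leftMul cs) q := by
  classical
  induction h with
  | one =>
    rw [FreeAlgebra.lift_ι_apply, map_one]
    have h := leftMul_eq cs (ω := []) (by simp [CoxeterSystem.IsReduced])
    simpa using h
  | mul x y h =>
    rw [map_mul, FreeAlgebra.lift_ι_apply, FreeAlgebra.lift_ι_apply, FreeAlgebra.lift_ι_apply,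
      leftMul_mul cs x y h]
  | quad i =>
    rw [map_mul, map_add, map_sub, FreeAlgebra.lift_ι_apply, AlgHom.commutes, AlgHom.commutes,
      map_zero, leftMul_simple]
    have hc (k : ℤ) (j : B) : Commute (algebraMap ℤ[T;T⁻¹]
        (Module.End ℤ[T;T⁻¹] (W →₀ ℤ[T;T⁻¹])) (T k)) (rightOp cs j) := Algebra.commutes _ _
    have hl (j : B) : Commute (leftOp cs i) (rightOp cs j) := leftOp_rightOp_comm cs i j
    refine eq_of_commute_rightOp cs
      (fun j => ((hl j).add_left (hc _ j)).mul_left ?_)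
      (fun j => Commute.zero_left _) ?_
    · exact Commute.sub_left (R := Module.End ℤ[T;T⁻¹] (W →₀ ℤ[T;T⁻¹])) (hl j) (hc (-1) j)
    have h1 : ¬ cs.IsLeftDescent 1 i := cs.not_isLeftDescent_one i
    have h2 : cs.IsLeftDescent (cs.simple i) i := by
      rw [IsLeftDescent, cs.simple_mul_simple_self]; simp
    have h3 : (T 1 : ℤ[T;T⁻¹]) * T (-1) = 1 := by rw [← T_add]; simp
    simp only [Module.End.mul_apply, LinearMap.add_apply, LinearMap.sub_apply,
      Module.algebraMap_end_apply, leftOp_single, map_sub, map_smul, mul_one, if_neg h1,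
      if_pos h2, add_zero, cs.simple_mul_simple_self, LinearMap.zero_apply]
    linear_combination (norm := module) -(h3 • Finsupp.single (1 : W) (1 : ℤ[T;T⁻¹]))

/-- The left regular representation of the Hecke algebra on the free module on `W`. -/
def regular : Hecke cs →ₐ[ℤ[T;T⁻¹]] Module.End ℤ[T;T⁻¹] (W →₀ ℤ[T;T⁻¹]) :=
  heckeLift cs (leftMul cs) (leftMul_rel cs)

theorem regular_δ (w : W) : regular cs (δ cs w) = leftMul cs w :=
  heckeLift_δ cs _ (leftMul_rel cs) w

theorem regular_δ_single_one (w : W) :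
    regular cs (δ cs w) (Finsupp.single 1 1) = Finsupp.single w 1 := by
  rw [regular_δ, leftMul_single_one]

end Regular

/-! ### Subsets and minimal coset representatives in type B -/

section Words

/-- `s_i` increases the subset `x`: it adds `1` (if `i = 0`) or replaces `i` by `i + 1`. -/
def IsUp (i : ℕ) (x : Finset ℕ) : Prop := (i = 0 ∨ i ∈ x) ∧ i + 1 ∉ x

theorem step_eq_of_isUp {i : ℕ} {x : Finset ℕ} (h : IsUp i x) (h0 : 0 ∉ x) :
    step i x = insert (i + 1) (x.erase i) := by
  obtain ⟨h1, h2⟩ := h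
  ext k
  rcases eq_or_ne i 0 with rfl | hi
  · rw [mem_step_zero]; grind
  · rw [mem_step_pos hi, Equiv.swap_apply_def]; grind

theorem zero_notMem_step {i : ℕ} {x : Finset ℕ} (h0 : 0 ∉ x) : 0 ∉ step i x := by
  rcases eq_or_ne i 0 with rfl | hi
  · rw [mem_step_zero]; simpa using h0
  · rw [mem_step_pos hi, Equiv.swap_apply_def]; grind

theorem step_subset_Icc {n i : ℕ} (hi : i < n) {x : Finset ℕ} (hx : x ⊆ Finset.Icc 1 n) :
    step i x ⊆ Finset.Icc 1 n := by
  intro k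
  have h := fun k => @hx k
  simp only [Finset.mem_Icc] at h ⊢
  rcases eq_or_ne i 0 with rfl | hi
  · rw [mem_step_zero]; grind
  · rw [mem_step_pos hi, Equiv.swap_apply_def]; grind

theorem step_trichotomy (i : ℕ) (x : Finset ℕ) :
    IsUp i x ∨ IsUp i (step i x) ∨ i ≠ 0 ∧ (i ∈ x ↔ i + 1 ∈ x) ∧ step i x = x := by
  rcases eq_or_ne i 0 with rfl | hi
  · simp only [IsUp, mem_step_zero]; grind
  · have h : (i ∈ x ↔ i + 1 ∈ x) → step i x = x := by
      intro h; ext k; rw [mem_step_pos hi, Equiv.swap_apply_def]; grind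
    simp only [IsUp, mem_step_pos hi, Equiv.swap_apply_def] at h ⊢
    grind

theorem sum_step_of_isUp {i : ℕ} {x : Finset ℕ} (h : IsUp i x) (h0 : 0 ∉ x) :
    ∑ t ∈ step i x, t = ∑ t ∈ x, t + 1 := by
  rw [step_eq_of_isUp h h0, Finset.sum_insert (fun h' => h.2 (Finset.mem_of_mem_erase h'))]
  rcases h.1 with rfl | hi
  · rw [Finset.erase_eq_of_notMem h0]; omega
  · have := Finset.add_sum_erase x id hi
    simp only [id] at this; omega

theorem isUp_of_sum_step {i : ℕ} {x : Finset ℕ} (h0 : 0 ∉ x)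
    (h : ∑ t ∈ step i x, t = ∑ t ∈ x, t + 1) : IsUp i x := by
  rcases step_trichotomy i x with h1 | h1 | ⟨-, -, h1⟩
  · exact h1
  · have := sum_step_of_isUp h1 (zero_notMem_step h0)
    rw [step_step] at this; omega
  · rw [h1] at h; omega

variable {n : ℕ} {W : Type*} [Group W] (cs : CoxeterSystem (typeB n) W)

theorem subsetOf_subset_Icc (w : W) : subsetOf cs w ⊆ Finset.Icc 1 n := by
  induction w using cs.simple_induction_right with
  | one => simp [subsetOf_one]
  | mul_simple_right w i ih => rw [subsetOf_mul_simple]; exact step_subset_Icc i.2 ih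

theorem zero_notMem_of_subset_Icc {n : ℕ} {x : Finset ℕ} (hx : x ⊆ Finset.Icc 1 n) : 0 ∉ x :=
  fun h => by simpa using hx h

theorem simple_comm {i j : Fin n} (h : i.1 + 1 < j.1) :
    cs.simple i * cs.simple j = cs.simple j * cs.simple i := by
  have h1 := cs.simple_mul_simple_pow i j
  rw [typeB_apply, if_neg (fun h' => by simp [h'] at h), if_neg (by omega), if_neg (by omega)] at h1
  calc cs.simple i * cs.simple j = (cs.simple i * cs.simple j)⁻¹ := by
        rw [eq_inv_iff_mul_eq_one, ← pow_two, h1]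
    _ = _ := by simp

theorem simple_braid {i j : Fin n} (hi : i.1 ≠ 0) (h : i.1 + 1 = j.1) :
    cs.simple i * cs.simple j * cs.simple i = cs.simple j * cs.simple i * cs.simple j := by
  have h1 := cs.simple_mul_simple_pow i j
  rw [typeB_apply, if_neg (fun h' => by simp [h'] at h), if_neg (by omega), if_pos (by omega)] at h1
  calc cs.simple i * cs.simple j * cs.simple i
      = (cs.simple j * cs.simple i * cs.simple j)⁻¹ := by
        rw [eq_inv_iff_mul_eq_one, ← h1]; simp only [pow_succ, pow_zero, one_mul, mul_assoc]
    _ = _ := by simp [mul_assoc]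

theorem simple_braid_four {i j : Fin n} (hi : i.1 = 0) (hj : j.1 = 1) :
    cs.simple i * cs.simple j * cs.simple i * cs.simple j =
      cs.simple j * cs.simple i * cs.simple j * cs.simple i := by
  have h1 := cs.simple_mul_simple_pow i j
  rw [typeB_apply, if_neg (fun h' => by rw [h'] at hi; omega), if_pos (by omega)] at h1
  calc cs.simple i * cs.simple j * cs.simple i * cs.simple j
      = (cs.simple i * cs.simple j * cs.simple i * cs.simple j)⁻¹ := by
        rw [eq_inv_iff_mul_eq_one, ← h1]; simp only [pow_succ, pow_zero, one_mul, mul_assoc]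
    _ = _ := by simp [mul_assoc]

theorem row_succ {t : ℕ} (ht : t < n) : row n (t + 1) = row n t ++ [⟨t, ht⟩] := by
  simp [row, List.range_succ, List.filterMap_append, ht]

theorem rowExpr_insert {a : ℕ} {y : Finset ℕ} (h : ∀ b ∈ y, b < a) :
    rowExpr n (insert a y) = row n a ++ rowExpr n y := by
  rw [rowExpr, Finset.sort_insert _ (fun b hb => (h b hb).le) (fun ha => (h a ha).false),
    List.flatMap_cons, rowExpr]

/-- The row of b uses only letters of index below b, hence at most i - 2, and these commute with
s_i. -/
theorem simple_comm_rowExpr {i : Fin n} {y : Finset ℕ} (h : ∀ b ∈ y, b < i.1) :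
    cs.wordProd (rowExpr n y) * cs.simple i = cs.simple i * cs.wordProd (rowExpr n y) := by
  have key : ∀ l : List (Fin n), (∀ j ∈ l, j.1 + 1 < i.1) →
      cs.wordProd l * cs.simple i = cs.simple i * cs.wordProd l := by
    intro l hl
    induction l with
    | nil => simp
    | cons j l ih =>
      rw [cs.wordProd_cons, mul_assoc, ih fun k hk => hl k (by simp [hk]), ← mul_assoc,
        simple_comm cs (hl j (by simp)), mul_assoc]
  refine key _ fun j hj => ?_
  simp only [rowExpr, row, List.mem_flatMap, Finset.mem_sort, List.mem_filterMap,
    List.mem_range] at hj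
  obtain ⟨b, hb, k, hk, hj⟩ := hj
  have := h b hb
  split_ifs at hj with hkn
  have : k = j.1 := by simpa using congrArg Fin.val (Option.some_injective _ hj)
  omega

/-- Rows are concatenated by decreasing length. If i is the maximum of x, then s_i commutes past all
later rows and lengthens the first one; otherwise it acts on the remaining rows. -/
theorem wordProd_rowExpr_mul_simple {x : Finset ℕ} (hx : x ⊆ Finset.Icc 1 n) {i : Fin n}
    (h : IsUp i x) :
    cs.wordProd (rowExpr n x) * cs.simple i = cs.wordProd (rowExpr n (step i x)) := by
  induction x using Finset.induction_on_max with
  | empty =>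
    rw [step_eq_of_isUp h (by simp)]
    have hi : i.1 = 0 := by simpa [IsUp] using h
    have e := row_succ i.2
    rw [show (∅ : Finset ℕ).erase i = ∅ by simp, rowExpr_insert (by simp), e]
    have : i = ⟨0, hi ▸ i.2⟩ := Fin.ext hi
    simpa [rowExpr, row, hi] using congrArg cs.simple this
  | insert a y ha ih =>
    have h0 := zero_notMem_of_subset_Icc hx
    have ha1 : 1 ≤ a := (Finset.mem_Icc.1 (hx (Finset.mem_insert_self a y))).1
    rw [rowExpr_insert ha, cs.wordProd_append]
    by_cases hai : a = i.1
    · subst hai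
      have hi : i.1 ∉ y := fun h => (ha _ h).false
      rw [step_eq_of_isUp h h0, Finset.erase_insert hi,
        rowExpr_insert (fun b hb => (ha b hb).trans (Nat.lt_succ_self _)), row_succ i.2, mul_assoc,
        simple_comm_rowExpr cs ha]
      simp [cs.wordProd_append, cs.wordProd_cons]
    · have h1 : IsUp i y := by simp only [IsUp, Finset.mem_insert] at h ⊢; grind
      have h2 : i.1 + 1 < a := by
        have h2 := h.2
        simp only [Finset.mem_insert] at h2
        rcases h1.1 with h3 | h3
        · omega
        · have := ha _ h3; omega
      have h0y : 0 ∉ y := fun h => h0 (Finset.mem_insert_of_mem h)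
      rw [mul_assoc, ih ((Finset.subset_insert _ _).trans hx) h1, ← cs.wordProd_append,
        ← rowExpr_insert]
      · rw [step_eq_of_isUp h h0, step_eq_of_isUp h1 h0y]
        have e : (insert a y).erase i.1 = insert a (y.erase i.1) :=
          Finset.erase_insert_of_ne hai
        rw [e, Finset.insert_comm]
      · rw [step_eq_of_isUp h1 h0y]
        simp only [Finset.mem_insert, Finset.mem_erase]; grind

theorem wordProd_rowExpr_of_isUp_step {x : Finset ℕ} (hx : x ⊆ Finset.Icc 1 n) {i : Fin n}
    (h : IsUp i (step i x)) :
    cs.wordProd (rowExpr n x) = cs.wordProd (rowExpr n (step i x)) * cs.simple i := by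
  rw [wordProd_rowExpr_mul_simple cs (step_subset_Icc i.2 hx) h, step_step]

/-- An explicit form of Deodhar's lemma: when s_i fixes the subset x, it can be moved through the
representative and becomes a simple reflection of W_I. The induction strips the final letters of the
representative and uses commutation or braid relations. -/
theorem exists_simple_mul_wordProd_rowExpr {x : Finset ℕ} (hx : x ⊆ Finset.Icc 1 n) {i : Fin n}
    (hi : i.1 ≠ 0) (h : i.1 ∈ x ↔ i.1 + 1 ∈ x) :
    ∃ j : Fin n, j.1 ≠ 0 ∧
      cs.wordProd (rowExpr n x) * cs.simple i = cs.simple j * cs.wordProd (rowExpr n x) := by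
  induction hN : ∑ t ∈ x, t using Nat.strong_induction_on generalizing x i with
  | _ N ih =>
  rcases x.eq_empty_or_nonempty with rfl | hne
  · exact ⟨i, hi, by simp [rowExpr]⟩
  -- The minimum `k + 1` of `x` can be lowered, so the representative may be taken to end in `s_k`.
  set a := x.min' hne with ha
  have hax : a ∈ x := x.min'_mem hne
  have hmin : ∀ b ∈ x, a ≤ b := fun b hb => x.min'_le b hb
  clear_value a
  have han := Finset.mem_Icc.1 (hx hax)
  obtain ⟨k, rfl⟩ : ∃ k, a = k + 1 := ⟨a - 1, by omega⟩
  have hk : k < n := by omega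
  have hkx : k ∉ x := fun h => by have := hmin k h; omega
  have hup : IsUp k (step k x) := by
    rcases eq_or_ne k 0 with rfl | hk0
    · simp only [IsUp, mem_step_zero]; simp [hax]
    · simp only [IsUp, mem_step_pos hk0, Equiv.swap_apply_def]; simp [hax, hkx]
  have hx1 := step_subset_Icc hk hx
  have hz1 := zero_notMem_of_subset_Icc hx1
  have hs1 := sum_step_of_isUp hup hz1
  rw [step_step] at hs1
  have e1 := wordProd_rowExpr_of_isUp_step cs hx (i := ⟨k, hk⟩) hup
  simp only at e1
  by_cases hfar : k + 1 < i.1 ∨ i.1 + 1 < k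
  · have hflat : i.1 ∈ step k x ↔ i.1 + 1 ∈ step k x := by
      rcases eq_or_ne k 0 with rfl | hk0
      · rw [mem_step_zero, mem_step_zero]; grind
      · rw [mem_step_pos hk0, mem_step_pos hk0, Equiv.swap_apply_def, Equiv.swap_apply_def]; grind
    obtain ⟨j, hj, e⟩ := ih _ (by omega) hx1 hi hflat rfl
    refine ⟨j, hj, ?_⟩
    have hc : cs.simple ⟨k, hk⟩ * cs.simple i = cs.simple i * cs.simple ⟨k, hk⟩ := by
      rcases hfar with hf | hf
      · exact simple_comm cs hf
      · exact (simple_comm cs (j := ⟨k, hk⟩) hf).symm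
    rw [e1, mul_assoc, hc, ← mul_assoc, e, mul_assoc]
  have hki : k = i.1 + 1 ∨ k + 1 = i.1 := by
    by_contra hcon
    have : k = i.1 := by omega
    subst this
    exact hkx (h.2 hax)
  have hup2 : IsUp i (step i (step k x)) := by
    rcases hki with rfl | hki
    · simp only [IsUp, mem_step_pos hi, mem_step_pos (Nat.succ_ne_zero i.1), Equiv.swap_apply_def]
      have : i.1 ∉ x := fun h => by have := hmin _ h; omega
      grind
    · rcases eq_or_ne k 0 with rfl | hk0
      · simp only [IsUp, mem_step_pos hi, mem_step_zero, Equiv.swap_apply_def]; grind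
      · simp only [IsUp, mem_step_pos hi, mem_step_pos hk0, Equiv.swap_apply_def]; grind
  have hx2 := step_subset_Icc i.2 hx1
  have hz2 := zero_notMem_of_subset_Icc hx2
  have hs2 := sum_step_of_isUp hup2 hz2
  rw [step_step] at hs2
  have e2 := wordProd_rowExpr_of_isUp_step cs hx1 hup2
  rw [e2] at e1
  -- If `k = 0`, then `i = 1` and the representative ends in `s_0 s_1 s_0`, so the relation of order
  -- 4 applies. Otherwise it ends in `s_i s_k`, and the relation of order 3 replaces the letter
  -- `s_i` by `s_k` for the shorter word.
  by_cases hk0 : k = 0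
  · subst hk0
    have hup3 : IsUp 0 (step 0 (step i (step 0 x))) := by
      simp only [IsUp, mem_step_pos hi, mem_step_zero, Equiv.swap_apply_def]; grind
    have hx3 := step_subset_Icc hk hx2
    have hs3 := sum_step_of_isUp hup3 (zero_notMem_of_subset_Icc hx3)
    rw [step_step] at hs3
    have e3 := wordProd_rowExpr_of_isUp_step cs hx2 (i := ⟨0, hk⟩) hup3
    simp only at e3
    rw [e3] at e1
    have hflat : i.1 ∈ step 0 (step i (step 0 x)) ↔ i.1 + 1 ∈ step 0 (step i (step 0 x)) := by
      simp only [mem_step_pos hi, mem_step_zero, Equiv.swap_apply_def]; grind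
    obtain ⟨j, hj, e⟩ := ih _ (by omega) hx3 hi hflat rfl
    refine ⟨j, hj, ?_⟩
    have hb := simple_braid_four cs (i := ⟨0, hk⟩) (j := i) rfl (by omega)
    simp only [mul_assoc] at hb
    rw [e1]
    simp only [mul_assoc]
    rw [hb, ← mul_assoc, e, mul_assoc]
  · have hflat : k ∈ step i (step k x) ↔ k + 1 ∈ step i (step k x) := by
      have : k = i.1 + 1 → i.1 ∉ x := fun h1 h => by have := hmin _ h; omega
      simp only [mem_step_pos hi, mem_step_pos hk0, Equiv.swap_apply_def]; grind
    obtain ⟨j, hj, e⟩ := ih _ (by omega) hx2 (i := ⟨k, hk⟩) hk0 hflat rfl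
    refine ⟨j, hj, ?_⟩
    have hb : cs.simple i * cs.simple ⟨k, hk⟩ * cs.simple i =
        cs.simple ⟨k, hk⟩ * cs.simple i * cs.simple ⟨k, hk⟩ := by
      rcases hki with hki | hki
      · exact simple_braid cs hi hki.symm
      · exact (simple_braid cs (i := ⟨k, hk⟩) (j := i) hk0 hki).symm
    simp only [mul_assoc] at hb
    rw [e1]
    simp only [mul_assoc]
    rw [hb, ← mul_assoc, e, mul_assoc]

theorem exists_parabolic_mul (w : W) : ∃ u ∈ parabolic cs (typeA n),
    w = u * cs.wordProd (rowExpr n (subsetOf cs w)) := by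
  induction w using cs.simple_induction_right with
  | one => exact ⟨1, one_mem _, by simp [subsetOf_one, rowExpr]⟩
  | mul_simple_right w i ih =>
    obtain ⟨u, hu, e⟩ := ih
    have hx := subsetOf_subset_Icc cs w
    rw [subsetOf_mul_simple]
    rcases step_trichotomy i (subsetOf cs w) with h | h | ⟨hi, h, h'⟩
    · exact ⟨u, hu, by rw [← wordProd_rowExpr_mul_simple cs hx h, ← mul_assoc, ← e]⟩
    · refine ⟨u, hu, ?_⟩
      rw [wordProd_rowExpr_of_isUp_step cs hx h, ← mul_assoc] at e
      conv_lhs => rw [e, cs.simple_mul_simple_cancel_right]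
    · obtain ⟨j, hj, e'⟩ := exists_simple_mul_wordProd_rowExpr cs hx hi h
      refine ⟨u * cs.simple j, mul_mem hu (Subgroup.subset_closure ⟨j, hj, rfl⟩), ?_⟩
      rw [h', mul_assoc, ← e', ← mul_assoc, ← e]

/-- A letter raises the sum of the subset by at most one, which bounds the length from below. The
row word lies in the same coset and has at most that many letters, so minimality gives the upper
bound. -/
theorem length_minCosetRep (w : MinCosetRep cs (typeA n)) :
    cs.length w.1 = ∑ t ∈ subsetOf cs w.1, t := by
  obtain ⟨u, hu, e⟩ := exists_parabolic_mul cs w.1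
  have h := w.2 u⁻¹ (inv_mem hu)
  have h2 := (cs.length_wordProd_le _).trans (length_rowExpr_le n (subsetOf cs w.1))
  have h3 : u⁻¹ * w.1 = cs.wordProd (rowExpr n (subsetOf cs w.1)) := by
    conv_lhs => rw [e]
    group
  rw [h3] at h
  exact le_antisymm (h.trans h2) (sum_subsetOf_le cs w.1)

/-- If `w s_i` is longer than `w` and minimal in its coset, then so is `w`. -/
theorem minimal_of_mul_simple {I : Set (Fin n)} {w : W} {i : Fin n}
    (hl : cs.length (w * cs.simple i) = cs.length w + 1)
    (h : ∀ u ∈ parabolic cs I, cs.length (w * cs.simple i) ≤ cs.length (u * (w * cs.simple i))) :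
    ∀ u ∈ parabolic cs I, cs.length w ≤ cs.length (u * w) := by
  intro u hu
  have h1 := h u hu
  have h2 := cs.length_mul_simple (u * w) i
  rw [← mul_assoc] at h1
  omega

theorem isUp_of_minimal {w : W} {i : Fin n}
    (hl : cs.length (w * cs.simple i) = cs.length w + 1)
    (h : ∀ u ∈ parabolic cs (typeA n),
      cs.length (w * cs.simple i) ≤ cs.length (u * (w * cs.simple i))) :
    IsUp i (subsetOf cs w) := by
  refine isUp_of_sum_step (zero_notMem_of_subset_Icc (subsetOf_subset_Icc cs w)) ?_
  rw [← subsetOf_mul_simple]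
  have h1 := length_minCosetRep cs ⟨_, h⟩
  have h2 := length_minCosetRep cs ⟨_, minimal_of_mul_simple cs hl h⟩
  simp only at h1 h2
  omega

/-- A minimal representative is recovered from its subset: removing a final descent leaves a minimal
representative, and restoring that letter is an upward step on row words. -/
theorem wordProd_rowExpr_subsetOf (w : MinCosetRep cs (typeA n)) :
    cs.wordProd (rowExpr n (subsetOf cs w.1)) = w.1 := by
  obtain ⟨w, hw⟩ := w
  simp only
  induction hN : cs.length w generalizing w with
  | zero =>
    rw [cs.length_eq_zero_iff] at hN
    simp [hN, subsetOf_one, rowExpr]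
  | succ N ih =>
    obtain ⟨i, hi⟩ := cs.exists_rightDescent_of_ne_one (w := w) (by rintro rfl; simp at hN)
    obtain ⟨w, rfl⟩ : ∃ w', w = w' * cs.simple i := ⟨w * cs.simple i, by simp⟩
    rw [cs.isRightDescent_iff, cs.simple_mul_simple_cancel_right] at hi
    rw [subsetOf_mul_simple, ← wordProd_rowExpr_mul_simple cs (subsetOf_subset_Icc cs w)
      (isUp_of_minimal cs hi.symm hw), ih w (minimal_of_mul_simple cs hi.symm hw) (by omega)]

theorem ofSubset_subsetOf (w : MinCosetRep cs (typeA n)) :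
    ofSubset cs (subsetOf cs w.1) = w := by
  refine Subtype.ext ?_
  rw [ofSubset]
  simp only [Finset.inter_eq_left.2 (subsetOf_subset_Icc cs w.1)]
  exact wordProd_rowExpr_subsetOf cs w

theorem ofSubset_val {x : Finset ℕ} (hx : x ⊆ Finset.Icc 1 n) :
    (ofSubset cs x).1 = cs.wordProd (rowExpr n x) := by
  simp only [ofSubset, Finset.inter_eq_left.2 hx]

theorem length_ofSubset {x : Finset ℕ} (hx : x ⊆ Finset.Icc 1 n) :
    cs.length (ofSubset cs x).1 = ∑ t ∈ x, t := by
  rw [length_minCosetRep, subsetOf_ofSubset cs hx]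

theorem ofSubset_mul_simple {x : Finset ℕ} (hx : x ⊆ Finset.Icc 1 n) {i : Fin n} (h : IsUp i x) :
    (ofSubset cs x).1 * cs.simple i = (ofSubset cs (step i x)).1 := by
  rw [ofSubset_val cs hx, ofSubset_val cs (step_subset_Icc i.2 hx),
    wordProd_rowExpr_mul_simple cs hx h]

theorem exists_simple_mul_ofSubset {x : Finset ℕ} (hx : x ⊆ Finset.Icc 1 n) {i : Fin n}
    (hi : i.1 ≠ 0) (h : i.1 ∈ x ↔ i.1 + 1 ∈ x) :
    ∃ j : Fin n, j.1 ≠ 0 ∧ (ofSubset cs x).1 * cs.simple i = cs.simple j * (ofSubset cs x).1 := by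
  rw [ofSubset_val cs hx]
  exact exists_simple_mul_wordProd_rowExpr cs hx hi h

end Words

/-! ### Scalars and the involution on the antispherical module -/

section Module

open LaurentPolynomial

variable {B : Type*} {M : CoxeterMatrix B} {W : Type*} [Group W] (cs : CoxeterSystem M W)
  (I : Set B)

theorem smul_oneTensor (r : ℤ[T;T⁻¹]) (h : Hecke cs) :
    r • oneTensor cs I h = oneTensor cs I (scalar cs r * h) := by
  rw [scalar, ← Algebra.smul_def]; rfl

theorem oneTensor_add (h h' : Hecke cs) :
    oneTensor cs I (h + h') = oneTensor cs I h + oneTensor cs I h' := map_add _ _ _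

theorem oneTensor_sub (h h' : Hecke cs) :
    oneTensor cs I (h - h') = oneTensor cs I h - oneTensor cs I h' := map_sub _ _ _

theorem oneTensor_mul (h h' : Hecke cs) :
    oneTensor cs I (h * h') = oneTensor cs I h <• h' := rfl

theorem oneTensor_surjective : Function.Surjective (oneTensor cs I) :=
  Submodule.mkQ_surjective _

theorem barN_smul (r : ℤ[T;T⁻¹]) (m : Antisph cs I) :
    barN cs I (r • m) = invert r • barN cs I m := by
  obtain ⟨h, rfl⟩ := oneTensor_surjective cs I m
  rw [smul_oneTensor, barN_oneTensor, barN_oneTensor, map_mul, bar_scalar, smul_oneTensor]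

theorem barN_op_smul (m : Antisph cs I) (h : Hecke cs) :
    barN cs I (m <• h) = barN cs I m <• bar cs h := by
  obtain ⟨h', rfl⟩ := oneTensor_surjective cs I m
  rw [← oneTensor_mul, barN_oneTensor, barN_oneTensor, map_mul, oneTensor_mul]

theorem oneTensor_δ_simple_mul {i : B} (hi : i ∈ I) (h : Hecke cs) :
    oneTensor cs I (δ cs (cs.simple i) * h) = (-T 1 : ℤ[T;T⁻¹]) • oneTensor cs I h := by
  have hmem : δ cs (cs.simple i) - scalar cs (sgn cs (δ cs (cs.simple i))) ∈
      antisphericalKer cs I :=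
    Submodule.subset_span ⟨_, Algebra.subset_adjoin ⟨i, hi, rfl⟩, rfl⟩
  have h2 := (antisphericalKer cs I).smul_mem (MulOpposite.op h) hmem
  rw [smul_oneTensor, ← sub_eq_zero, ← oneTensor_sub]
  refine (Submodule.Quotient.mk_eq_zero _).2 ?_
  rw [sgn_δ, cs.length_simple, pow_one, op_smul_eq_mul, sub_mul] at h2
  exact h2

end Module

/-! ### Coordinates in the standard basis, and uniqueness of the Kazhdan–Lusztig basis -/

section Coordinates

open LaurentPolynomial

variable {n : ℕ} {W : Type*} [Group W] (cs : CoxeterSystem (typeB n) W)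

/-- The linear map from the free module on `W` that sends `w` to `(-v) ^ ℓ(u)` times its coset
representative `x`, where `w = u x`. -/
def cosetMap : (W →₀ ℤ[T;T⁻¹]) →ₗ[ℤ[T;T⁻¹]] (MinCosetRep cs (typeA n) →₀ ℤ[T;T⁻¹]) :=
  Finsupp.linearCombination ℤ[T;T⁻¹] fun w => Finsupp.single (ofSubset cs (subsetOf cs w))
    ((-T 1) ^ (cs.length w - ∑ t ∈ subsetOf cs w, t))

theorem subsetOf_simple_mul {i : Fin n} (hi : i ∈ typeA n) (w : W) :
    subsetOf cs (cs.simple i * w) = subsetOf cs w :=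
  subsetOf_parabolic_mul cs (Subgroup.subset_closure ⟨i, hi, rfl⟩) w

/-- Left multiplication by s_i ∈ W_I keeps the subset and changes the length by one. At a descent
this comes down to 1 + (v⁻¹ - v)(-v) = v². The truncated subtraction in the exponents is harmless by
`sum_subsetOf_le`. -/
theorem cosetMap_leftOp {i : Fin n} (hi : i ∈ typeA n) (z : W →₀ ℤ[T;T⁻¹]) :
    cosetMap cs (leftOp cs i z) = (-T 1 : ℤ[T;T⁻¹]) • cosetMap cs z := by
  classical
  induction z using Finsupp.induction_linear with
  | zero => simp
  | add x y hx hy => rw [map_add, map_add, hx, hy, map_add, smul_add]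
  | single w r =>
    rw [← mul_one r, ← smul_eq_mul, ← Finsupp.smul_single, map_smul, map_smul, map_smul,
      smul_comm]
    congr 1
    have h1 := sum_subsetOf_le cs w
    have h2 := sum_subsetOf_le cs (cs.simple i * w)
    have h3 := cs.length_simple_mul w i
    rw [leftOp_single, map_add, apply_ite (cosetMap cs), map_smul, map_zero]
    simp only [cosetMap, Finsupp.linearCombination_single, one_smul]
    rw [subsetOf_simple_mul cs hi] at h2 ⊢
    split_ifs with hd
    · rw [CoxeterSystem.IsLeftDescent] at hd
      obtain ⟨m, hm⟩ := Nat.exists_eq_add_of_le h2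
      have e1 : cs.length (cs.simple i * w) - ∑ t ∈ subsetOf cs w, t = m := by omega
      have e2 : cs.length w - ∑ t ∈ subsetOf cs w, t = m + 1 := by omega
      rw [e1, e2, Finsupp.smul_single, Finsupp.smul_single, ← Finsupp.single_add]
      have h3 : (T 1 : ℤ[T;T⁻¹]) * T (-1) = 1 := by rw [← T_add]; simp
      congr 1
      simp only [smul_eq_mul, pow_succ]
      linear_combination (-(-T 1) ^ m) * h3
    · rw [CoxeterSystem.IsLeftDescent] at hd
      have e1 : cs.length (cs.simple i * w) - ∑ t ∈ subsetOf cs w, t =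
        (cs.length w - ∑ t ∈ subsetOf cs w, t) + 1 := by omega
      rw [e1, Finsupp.smul_single, add_zero, pow_succ', smul_eq_mul]

theorem cosetMap_regular {a : Hecke cs} (ha : a ∈ parabolicHecke cs (typeA n))
    (z : W →₀ ℤ[T;T⁻¹]) :
    cosetMap cs (regular cs a z) = sgn cs a • cosetMap cs z := by
  induction ha using Algebra.adjoin_induction generalizing z with
  | mem x hx =>
    obtain ⟨i, hi, rfl⟩ := hx
    simp only
    rw [regular_δ, leftMul_simple, cosetMap_leftOp cs hi, sgn_δ, cs.length_simple, pow_one]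
  | algebraMap r =>
    rw [AlgHom.commutes, AlgHom.commutes, Module.algebraMap_end_apply, map_smul]
    rfl
  | add x y _ _ hx hy => rw [map_add, LinearMap.add_apply, map_add, hx, hy, map_add, add_smul]
  | mul x y _ _ hx hy => rw [map_mul, Module.End.mul_apply, hx, hy, map_mul, mul_smul]

/-- The coordinates of `1 ⊗ h` with respect to the standard basis. -/
def coordHecke : Hecke cs →ₗ[ℤ[T;T⁻¹]] (MinCosetRep cs (typeA n) →₀ ℤ[T;T⁻¹]) :=
  cosetMap cs ∘ₗ LinearMap.applyₗ (Finsupp.single 1 1) ∘ₗ (regular cs).toLinearMap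

theorem coordHecke_eq_zero {h : Hecke cs} (hh : h ∈ antisphericalKer cs (typeA n)) :
    coordHecke cs h = 0 := by
  -- The kernel is a right submodule, so the induction needs vanishing on all right multiples.
  have key : ∀ h' : Hecke cs, coordHecke cs (h * h') = 0 := by
    induction hh using Submodule.span_induction with
    | mem x hx =>
      obtain ⟨a, ha, rfl⟩ := hx
      intro h'
      have e2 : regular cs (scalar cs (sgn cs a)) = algebraMap _ _ (sgn cs a) :=
        (regular cs).commutes _
      simp only [coordHecke, LinearMap.comp_apply, AlgHom.toLinearMap_apply,
        LinearMap.applyₗ_apply_apply]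
      rw [map_mul, Module.End.mul_apply, map_sub, LinearMap.sub_apply, map_sub,
        cosetMap_regular cs ha, e2, Module.algebraMap_end_apply, map_smul, sub_self]
    | zero => simp
    | add x y _ _ hx hy => intro h'; rw [add_mul, map_add, hx, hy, add_zero]
    | smul r x _ hx =>
      intro h'
      rw [← MulOpposite.op_unop r, op_smul_eq_mul, mul_assoc, hx]
  simpa using key 1

/-- The coordinates with respect to the standard basis `δ_x^I`. -/
def coord : Antisph cs (typeA n) →ₗ[ℤ[T;T⁻¹]] (MinCosetRep cs (typeA n) →₀ ℤ[T;T⁻¹]) where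
  __ := QuotientAddGroup.lift (antisphericalKer cs (typeA n)).toAddSubgroup
    (coordHecke cs).toAddMonoidHom fun _ hx => coordHecke_eq_zero cs hx
  map_smul' r m := by
    obtain ⟨h, rfl⟩ := oneTensor_surjective cs _ m
    exact map_smul (coordHecke cs) r h

/-- This gives the linear independence of the standard elements. -/
theorem coord_δN (x : MinCosetRep cs (typeA n)) : coord cs (δN cs _ x) = Finsupp.single x 1 := by
  have h : coord cs (δN cs _ x) = coordHecke cs (δ cs x.1) := rfl
  rw [h]
  simp only [coordHecke, LinearMap.comp_apply, AlgHom.toLinearMap_apply,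
    LinearMap.applyₗ_apply_apply, regular_δ_single_one, cosetMap,
    Finsupp.linearCombination_single, one_smul]
  rw [ofSubset_subsetOf, length_minCosetRep, Nat.sub_self, pow_zero]

theorem length_lt_of_bruhatLT {B : Type*} {M : CoxeterMatrix B} {W : Type*} [Group W]
    (cs : CoxeterSystem M W) {y z : W} (h : BruhatLT cs y z) : cs.length y < cs.length z := by
  induction h with
  | single h => obtain ⟨t, -, -, h⟩ := h; exact h
  | tail _ h ih => obtain ⟨t, -, -, h⟩ := h; exact ih.trans h

/-- The involution fixes δ_z^I up to standard elements of smaller length. Existence of a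
Kazhdan–Lusztig basis makes this easy: d_z is self-dual and differs from δ_z^I by shorter terms,
which are handled by induction. -/
theorem coord_barN_δN {d : MinCosetRep cs (typeA n) → Antisph cs (typeA n)}
    (hd : IsKLBasis cs (typeA n) d) (y z : MinCosetRep cs (typeA n))
    (h : cs.length z.1 ≤ cs.length y.1) :
    coord cs (barN cs _ (δN cs _ z)) y = coord cs (δN cs _ z) y := by
  induction hN : cs.length z.1 using Nat.strong_induction_on generalizing z with
  | _ N ih =>
  have key : coord cs (d z - δN cs _ z) y = 0 ∧ coord cs (barN cs _ (d z - δN cs _ z)) y = 0 := by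
    refine AddSubgroup.closure_induction (p := fun m _ => coord cs m y = 0 ∧
      coord cs (barN cs _ m) y = 0) ?_ ?_ ?_ ?_ (hd z).2
    · rintro _ ⟨z', k, hz', -, rfl⟩
      have hlt := length_lt_of_bruhatLT cs hz'
      have h0 : coord cs (δN cs _ z') y = 0 := by
        rw [coord_δN, Finsupp.single_eq_of_ne]
        rintro rfl
        omega
      rw [← smul_oneTensor, barN_smul, map_smul, map_smul, Finsupp.smul_apply, Finsupp.smul_apply]
      refine ⟨by rw [show oneTensor cs _ (δ cs z'.1) = δN cs _ z' from rfl, h0, smul_zero], ?_⟩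
      rw [show oneTensor cs _ (δ cs z'.1) = δN cs _ z' from rfl,
        ih _ (hN ▸ hlt) z' (by omega) rfl, h0, smul_zero]
    · simp
    · rintro a b - - ⟨ha, ha'⟩ ⟨hb, hb'⟩
      simp [ha, ha', hb, hb']
    · rintro a - ⟨ha, ha'⟩
      simp [ha, ha']
  have h1 := key.1
  have h2 := key.2
  rw [map_sub, (hd z).1] at h2
  rw [map_sub, Finsupp.sub_apply, sub_eq_zero] at h1 h2
  rw [← h2, h1]

/-- The coefficient at an element of maximal length in the support is invariant under v ↦ v⁻¹ and
lies in vℤ[v], so it is zero. -/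
theorem eq_zero_of_barN_eq {d : MinCosetRep cs (typeA n) → Antisph cs (typeA n)}
    (hd : IsKLBasis cs (typeA n) d) {m : Antisph cs (typeA n)}
    (hm : m ∈ AddSubgroup.closure {m | ∃ (y : MinCosetRep cs (typeA n)) (k : ℕ), 1 ≤ k ∧
        m = oneTensor cs _ (scalar cs (T k) * δ cs y.1)})
    (hbar : barN cs _ m = m) : m = 0 := by
  classical
  -- Besides positivity of the exponents, `m` must be recoverable from its coordinates, so that
  -- vanishing coordinates force `m = 0`.
  have key : (∀ y, ∀ k ≤ 0, (coord cs m y).coeff k = 0) ∧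
      m = Finsupp.linearCombination ℤ[T;T⁻¹] (δN cs (typeA n)) (coord cs m) := by
    clear hbar
    induction hm using AddSubgroup.closure_induction with
    | mem m hm =>
      obtain ⟨z, j, hj, rfl⟩ := hm
      rw [← smul_oneTensor, show oneTensor cs _ (δ cs z.1) = δN cs _ z from rfl, map_smul, coord_δN]
      refine ⟨fun y k hk => ?_, by simp⟩
      rw [Finsupp.smul_apply, Finsupp.single_apply]
      split_ifs
      · rw [smul_eq_mul, mul_one, T]
        simp only [AddMonoidAlgebra.coeff_single]
        rw [Finsupp.single_eq_of_ne]
        omega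
      · simp
    | zero => simp
    | add a b _ _ ha hb =>
      refine ⟨fun y k hk => ?_, ?_⟩
      · rw [map_add, Finsupp.add_apply, AddMonoidAlgebra.coeff_add, Finsupp.add_apply,
          ha.1 y k hk, hb.1 y k hk, add_zero]
      · rw [map_add, map_add, ← ha.2, ← hb.2]
    | neg a _ ha =>
      refine ⟨fun y k hk => ?_, ?_⟩
      · rw [map_neg, Finsupp.neg_apply, AddMonoidAlgebra.coeff_neg, Finsupp.neg_apply,
          ha.1 y k hk, neg_zero]
      · rw [map_neg, map_neg, ← ha.2]
  obtain ⟨hpos, hexp⟩ := key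
  set p := coord cs m with hp
  by_contra hne
  have hsupp : p.support.Nonempty := by
    rw [Finsupp.support_nonempty_iff]
    intro h0
    rw [h0, map_zero] at hexp
    exact hne hexp
  obtain ⟨y, hy, hmax⟩ := Finset.exists_max_image p.support (fun z => cs.length z.1) hsupp
  have h1 : p y = invert (p y) := by
    conv_lhs => rw [hp, ← hbar, hexp]
    rw [Finsupp.linearCombination_apply, Finsupp.sum, map_sum, map_sum, Finsupp.finsetSum_apply,
      Finset.sum_eq_single y]
    · rw [barN_smul, map_smul, Finsupp.smul_apply, coord_barN_δN cs hd y y le_rfl, coord_δN]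
      simp
    · intro z hz hzy
      rw [barN_smul, map_smul, Finsupp.smul_apply, coord_barN_δN cs hd y z (hmax z hz), coord_δN,
        Finsupp.single_eq_of_ne hzy.symm, smul_zero]
    · intro h; exact absurd hy h
  refine (Finsupp.mem_support_iff.1 hy) ?_
  ext k
  rcases le_or_gt k 0 with hk | hk
  · rw [hpos y k hk]; rfl
  · rw [h1, invert_apply, hpos y (-k) (by omega)]; rfl

theorem IsKLBasis.unique {d d' : MinCosetRep cs (typeA n) → Antisph cs (typeA n)}
    (hd : IsKLBasis cs (typeA n) d) (hd' : IsKLBasis cs (typeA n) d') : d' = d := by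
  funext x
  rw [← sub_eq_zero]
  refine eq_zero_of_barN_eq cs hd ?_ (by rw [map_sub, (hd x).1, (hd' x).1])
  have hle := AddSubgroup.closure_mono (G := Antisph cs (typeA n))
    (h := {m | ∃ (y : MinCosetRep cs (typeA n)) (k : ℕ), BruhatLT cs y.1 x.1 ∧ 1 ≤ k ∧
        m = oneTensor cs (typeA n) (scalar cs (T k) * δ cs y.1)})
    (k := {m | ∃ (y : MinCosetRep cs (typeA n)) (k : ℕ), 1 ≤ k ∧
        m = oneTensor cs (typeA n) (scalar cs (T k) * δ cs y.1)})
    (by rintro _ ⟨y, k, -, h⟩; exact ⟨y, k, h⟩)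
  have := sub_mem (hle (hd' x).2) (hle (hd x).2)
  simpa using this

end Coordinates

/-! ### Action of b_s on standard elements -/

section Action

open LaurentPolynomial

variable {n : ℕ} {W : Type*} [Group W] (cs : CoxeterSystem (typeB n) W)

/-- The standard element of the antispherical module attached to a subset of `{1, …, n}`. -/
def stdElt (x : Finset ℕ) : Antisph cs (typeA n) := δN cs _ (ofSubset cs x)

theorem stdElt_eq (x : Finset ℕ) : stdElt cs x = oneTensor cs _ (δ cs (ofSubset cs x).1) := rfl

theorem stdElt_smul_b (x : Finset ℕ) (i : Fin n) : stdElt cs x <• b cs i =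
    oneTensor cs _ (δ cs (ofSubset cs x).1 * δ cs (cs.simple i)) +
      (T 1 : ℤ[T;T⁻¹]) • stdElt cs x := by
  rw [stdElt_eq, ← oneTensor_mul, b, mul_add, ← scalar_comm, oneTensor_add, smul_oneTensor]

theorem stdElt_mul_simple {x : Finset ℕ} (hx : x ⊆ Finset.Icc 1 n) {i : Fin n} (h : IsUp i x) :
    δ cs (ofSubset cs x).1 * δ cs (cs.simple i) = δ cs (ofSubset cs (step i x)).1 := by
  rw [δ_mul, ofSubset_mul_simple cs hx h]
  rw [ofSubset_mul_simple cs hx h, length_ofSubset cs hx,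
    length_ofSubset cs (step_subset_Icc i.2 hx), cs.length_simple,
    sum_step_of_isUp h (zero_notMem_of_subset_Icc hx)]

theorem stdElt_smul_b_of_isUp {x : Finset ℕ} (hx : x ⊆ Finset.Icc 1 n) {i : Fin n}
    (h : IsUp i x) :
    stdElt cs x <• b cs i = stdElt cs (step i x) + (T 1 : ℤ[T;T⁻¹]) • stdElt cs x := by
  rw [stdElt_smul_b, stdElt_mul_simple cs hx h]; rfl

theorem stdElt_smul_b_of_isUp_step {x : Finset ℕ} (hx : x ⊆ Finset.Icc 1 n) {i : Fin n}
    (h : IsUp i (step i x)) :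
    stdElt cs x <• b cs i = stdElt cs (step i x) + (T (-1) : ℤ[T;T⁻¹]) • stdElt cs x := by
  have e := stdElt_mul_simple cs (step_subset_Icc i.2 hx) h
  rw [step_step] at e
  have e2 : δ cs (cs.simple i) * δ cs (cs.simple i) = 1 + scalar cs (T (-1)) * δ cs (cs.simple i) -
      scalar cs (T 1) * δ cs (cs.simple i) := by
    have := δ_simple_mul_inv cs i
    rw [mul_sub, mul_add] at this
    rw [← this, ← scalar_comm, ← scalar_comm]; abel
  have e3 : δ cs (ofSubset cs x).1 * δ cs (cs.simple i) = δ cs (ofSubset cs (step i x)).1 +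
      scalar cs (T (-1)) * δ cs (ofSubset cs x).1 - scalar cs (T 1) * δ cs (ofSubset cs x).1 := by
    rw [← e, mul_assoc, e2, mul_sub, mul_add, mul_one, ← mul_assoc, ← mul_assoc, ← scalar_comm,
      ← scalar_comm, mul_assoc, mul_assoc]
  rw [stdElt_smul_b, e3, oneTensor_sub, oneTensor_add, ← smul_oneTensor, ← smul_oneTensor,
    ← stdElt_eq, ← stdElt_eq]
  abel

/-- Here x s_i = s_j x with s_j ∈ W_I, and both sides are longer than x. Hence δ_{s_i} acts on δ_x^I
as -v, which cancels the v in b_{s_i}. -/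
theorem stdElt_smul_b_of_flat {x : Finset ℕ} (hx : x ⊆ Finset.Icc 1 n) {i : Fin n}
    (hi : i.1 ≠ 0) (h : i.1 ∈ x ↔ i.1 + 1 ∈ x) :
    stdElt cs x <• b cs i = 0 := by
  obtain ⟨j, hj, e⟩ := exists_simple_mul_ofSubset cs hx hi h
  have hl : cs.length (cs.simple j * (ofSubset cs x).1) = cs.length (ofSubset cs x).1 + 1 := by
    have h1 := (ofSubset cs x).2 _ (Subgroup.subset_closure ⟨j, hj, rfl⟩)
    have h2 := cs.length_simple_mul (ofSubset cs x).1 j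
    omega
  rw [stdElt_smul_b, δ_mul, e, ← δ_mul, oneTensor_δ_simple_mul cs _ (show j ∈ typeA n from hj),
    stdElt_eq, ← add_smul, neg_add_cancel, zero_smul]
  · rw [hl, cs.length_simple, add_comm]
  · rw [e, hl, cs.length_simple]

/-- Right multiplication by `b_i` as a linear map. -/
def mulB (i : Fin n) : Antisph cs (typeA n) →ₗ[ℤ[T;T⁻¹]] Antisph cs (typeA n) :=
  DistribSMul.toLinearMap ℤ[T;T⁻¹] _ (MulOpposite.op (b cs i))

theorem mulB_apply (i : Fin n) (m : Antisph cs (typeA n)) : mulB cs i m = m <• b cs i := rfl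

end Action

/-! ### Polynomial encoding and the local rules for b_s -/

section Polynomial

open LaurentPolynomial (T)
open MvPolynomial

variable {n : ℕ} {W : Type*} [Group W] (cs : CoxeterSystem (typeB n) W)

/-- The linear map that sends a monomial to the standard element of the set of its variables. -/
def ofPoly : MvPolynomial ℕ ℤ[T;T⁻¹] →ₗ[ℤ[T;T⁻¹]] Antisph cs (typeA n) :=
  (basisMonomials ℕ ℤ[T;T⁻¹]).constr ℤ[T;T⁻¹] fun m => stdElt cs m.support

theorem ofPoly_monomial (m : ℕ →₀ ℕ) : ofPoly cs (monomial m 1) = stdElt cs m.support := by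
  have h := (basisMonomials ℕ ℤ[T;T⁻¹]).constr_basis ℤ[T;T⁻¹]
    (fun m => stdElt cs m.support) m
  rwa [coe_basisMonomials] at h

theorem ofPoly_C_mul (r : ℤ[T;T⁻¹]) (P : MvPolynomial ℕ ℤ[T;T⁻¹]) :
    ofPoly cs (C r * P) = r • ofPoly cs P := by
  rw [C_mul', map_smul]

theorem ofPoly_monomial_mul_X (m : ℕ →₀ ℕ) (i : ℕ) :
    ofPoly cs (monomial m 1 * X i) = stdElt cs (insert i m.support) := by
  rw [X, monomial_mul, mul_one, ofPoly_monomial]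
  congr 1
  ext j
  simp only [Finsupp.mem_support_iff, Finsupp.add_apply, Finset.mem_insert, Finsupp.single_apply]
  grind

theorem ofPoly_monomial_mul_X_mul_X (m : ℕ →₀ ℕ) (i j : ℕ) :
    ofPoly cs (monomial m 1 * (X i * X j)) = stdElt cs (insert i (insert j m.support)) := by
  rw [X, X, monomial_mul, monomial_mul, mul_one, mul_one, ofPoly_monomial]
  congr 1
  ext j
  simp only [Finsupp.mem_support_iff, Finsupp.add_apply, Finset.mem_insert, Finsupp.single_apply]
  grind

/-- The indices of variables on which `b_i` does not act. -/
def farVars (n i : ℕ) : Set ℕ := {a | a ∈ Finset.Icc 1 n ∧ a ≠ i ∧ a ≠ i + 1}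

/-- `b_i` maps `P` to `P'`, also after multiplication by variables on which it does not act. -/
def Act (i : Fin n) (P P' : MvPolynomial ℕ ℤ[T;T⁻¹]) : Prop :=
  ∀ Q ∈ supported ℤ[T;T⁻¹] (farVars n i), ofPoly cs (Q * P) <• b cs i = ofPoly cs (Q * P')

variable {cs}

theorem Act.mul_left {i : Fin n} {P P' Q : MvPolynomial ℕ ℤ[T;T⁻¹]} (h : Act cs i P P')
    (hQ : Q ∈ supported ℤ[T;T⁻¹] (farVars n i)) : Act cs i (Q * P) (Q * P') := by
  intro Q' hQ'
  rw [← mul_assoc, ← mul_assoc]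
  exact h _ (mul_mem hQ' hQ)

theorem Act.add {i : Fin n} {P P' Q Q' : MvPolynomial ℕ ℤ[T;T⁻¹]} (h : Act cs i P P')
    (h' : Act cs i Q Q') : Act cs i (P + Q) (P' + Q') := by
  intro R hR
  rw [mul_add, mul_add, map_add, map_add, ← h R hR, ← h' R hR]
  exact map_add (mulB cs i) _ _

theorem Act.smul {i : Fin n} {P P' : MvPolynomial ℕ ℤ[T;T⁻¹]} (h : Act cs i P P')
    (r : ℤ[T;T⁻¹]) : Act cs i (C r * P) (C r * P') :=
  h.mul_left (Subalgebra.algebraMap_mem _ r)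

/-- By linearity the multiplier Q may be a monomial; its support is then a subset that avoids i and
i + 1. -/
theorem act_of_monomial {i : Fin n} {P P' : MvPolynomial ℕ ℤ[T;T⁻¹]}
    (h : ∀ m : ℕ →₀ ℕ, (∀ a ∈ m.support, a ∈ farVars n i) →
      ofPoly cs (monomial m 1 * P) <• b cs i = ofPoly cs (monomial m 1 * P')) :
    Act cs i P P' := by
  intro Q hQ
  rw [← mulB_apply, Q.as_sum, Finset.sum_mul, Finset.sum_mul, map_sum, map_sum, map_sum]
  refine Finset.sum_congr rfl fun m hm => ?_
  have e : (monomial m (coeff m Q) : MvPolynomial ℕ ℤ[T;T⁻¹]) = C (coeff m Q) * monomial m 1 := by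
    rw [C_mul_monomial, mul_one]
  rw [e, mul_assoc, mul_assoc, ofPoly_C_mul, ofPoly_C_mul, map_smul, mulB_apply, h]
  intro a ha
  exact mem_supported.1 hQ ((mem_vars_iff_mem_support a).2 ⟨m, hm, ha⟩)

variable (cs)

theorem act_X {i : Fin n} (hi : i.1 ≠ 0) :
    Act cs i (X i.1) (X (i.1 + 1) + C (T 1) * X i.1) := by
  refine act_of_monomial fun m hm => ?_
  have hm' : ∀ a ∈ m.support, (1 ≤ a ∧ a ≤ n) ∧ a ≠ i ∧ a ≠ i + 1 := by simpa [farVars] using hm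
  have h1 : insert i.1 m.support ⊆ Finset.Icc 1 n := by
    intro a; simp only [Finset.mem_insert, Finset.mem_Icc]; grind
  have h2 : IsUp i (insert i.1 m.support) := by simp only [IsUp, Finset.mem_insert]; grind
  rw [mul_add, mul_left_comm, map_add, ofPoly_C_mul, ofPoly_monomial_mul_X, ofPoly_monomial_mul_X,
    stdElt_smul_b_of_isUp cs h1 h2, step_eq_of_isUp h2 (zero_notMem_of_subset_Icc h1),
    Finset.erase_insert (by grind)]

theorem act_X_succ {i : Fin n} (hi : i.1 ≠ 0) :
    Act cs i (X (i.1 + 1)) (X i.1 + C (T (-1)) * X (i.1 + 1)) := by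
  refine act_of_monomial fun m hm => ?_
  have hm' : ∀ a ∈ m.support, (1 ≤ a ∧ a ≤ n) ∧ a ≠ i ∧ a ≠ i + 1 := by simpa [farVars] using hm
  have h1 : insert (i.1 + 1) m.support ⊆ Finset.Icc 1 n := by
    intro a; simp only [Finset.mem_insert, Finset.mem_Icc]; grind
  have h3 : step i.1 (insert (i.1 + 1) m.support) = insert i.1 m.support := by
    ext a; rw [mem_step_pos hi, Equiv.swap_apply_def]; simp only [Finset.mem_insert]; grind
  have h2 : IsUp i (step i (insert (i.1 + 1) m.support)) := by
    simp only [h3, IsUp, Finset.mem_insert]; grind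
  rw [mul_add, mul_left_comm, map_add, ofPoly_C_mul, ofPoly_monomial_mul_X, ofPoly_monomial_mul_X,
    stdElt_smul_b_of_isUp_step cs h1 h2, h3]

theorem act_one {i : Fin n} (hi : i.1 ≠ 0) : Act cs i 1 0 := by
  refine act_of_monomial fun m hm => ?_
  have hm' : ∀ a ∈ m.support, (1 ≤ a ∧ a ≤ n) ∧ a ≠ i ∧ a ≠ i + 1 := by simpa [farVars] using hm
  rw [mul_one, mul_zero, map_zero, ofPoly_monomial, stdElt_smul_b_of_flat cs _ hi (by grind)]
  intro a; simp only [Finset.mem_Icc]; grind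

theorem act_X_mul_X {i : Fin n} (hi : i.1 ≠ 0) : Act cs i (X i.1 * X (i.1 + 1)) 0 := by
  refine act_of_monomial fun m hm => ?_
  have hm' : ∀ a ∈ m.support, (1 ≤ a ∧ a ≤ n) ∧ a ≠ i ∧ a ≠ i + 1 := by simpa [farVars] using hm
  rw [mul_zero, map_zero, ofPoly_monomial_mul_X_mul_X, stdElt_smul_b_of_flat cs _ hi]
  · simp
  · intro a; simp only [Finset.mem_insert, Finset.mem_Icc]; grind

theorem act_zero_one {i : Fin n} (hi : i.1 = 0) : Act cs i 1 (X 1 + C (T 1)) := by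
  refine act_of_monomial fun m hm => ?_
  have hm' : ∀ a ∈ m.support, (1 ≤ a ∧ a ≤ n) ∧ a ≠ i ∧ a ≠ i + 1 := by simpa [farVars] using hm
  have h1 : m.support ⊆ Finset.Icc 1 n := by
    intro a; simp only [Finset.mem_Icc]; grind
  have h2 : IsUp i m.support := by simp only [IsUp]; grind
  have h3 := zero_notMem_of_subset_Icc h1
  rw [mul_add, mul_comm _ (C _), map_add, ofPoly_C_mul, mul_one, ofPoly_monomial_mul_X,
    ofPoly_monomial, stdElt_smul_b_of_isUp cs h1 h2, step_eq_of_isUp h2 h3, hi,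
    Finset.erase_eq_of_notMem h3]

theorem act_zero_X {i : Fin n} (hi : i.1 = 0) : Act cs i (X 1) (1 + C (T (-1)) * X 1) := by
  refine act_of_monomial fun m hm => ?_
  have hm' : ∀ a ∈ m.support, (1 ≤ a ∧ a ≤ n) ∧ a ≠ i ∧ a ≠ i + 1 := by simpa [farVars] using hm
  have h1 : insert 1 m.support ⊆ Finset.Icc 1 n := by
    intro a; simp only [Finset.mem_insert, Finset.mem_Icc]; grind
  have h3 : step i.1 (insert 1 m.support) = m.support := by
    ext a; rw [hi, mem_step_zero]; simp only [Finset.mem_insert]; grind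
  have h2 : IsUp i (step i (insert 1 m.support)) := by
    simp only [h3, IsUp]; grind
  rw [mul_add, mul_left_comm, mul_one, map_add, ofPoly_C_mul, ofPoly_monomial_mul_X,
    ofPoly_monomial, stdElt_smul_b_of_isUp_step cs h1 h2, h3]

end Polynomial

/-! ### Cup diagrams and the Bott–Samelson elements -/

section Diagram

open LaurentPolynomial (T)
open MvPolynomial

/-- The factor `X_p + v X_c` of a cup joining `c < p`. -/
def cup (c p : ℕ) : MvPolynomial ℕ ℤ[T;T⁻¹] := X p + C (T 1) * X c

/-- The factor of an unmatched element `p`: `X_p + 1` if `p` is even and `X_p + v` if `p` is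
odd. -/
def single (p : ℕ) : MvPolynomial ℕ ℤ[T;T⁻¹] := if Even p then X p + 1 else X p + C (T 1)

/-- The product of the factors of the cups and the unmatched elements of `x` that are found when
scanning the positions `p, …, p + r - 1`. The list holds the positions to the left of `p` that do
not lie in `x` and are not matched yet, the rightmost first. -/
def cupProd (x : Finset ℕ) : ℕ → ℕ → List ℕ → MvPolynomial ℕ ℤ[T;T⁻¹]
  | 0, _, _ => 1
  | r + 1, p, st => if p ∈ x then
      match st with
      | [] => single p * cupProd x r (p + 1) []
      | c :: st => cup c p * cupProd x r (p + 1) st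
    else cupProd x r (p + 1) (p :: st)

variable {x : Finset ℕ} {r p : ℕ}

theorem cupProd_of_notMem (h : p ∉ x) (st : List ℕ) :
    cupProd x (r + 1) p st = cupProd x r (p + 1) (p :: st) := by
  rw [cupProd.eq_def]; simp [h]

theorem cupProd_nil_of_mem (h : p ∈ x) :
    cupProd x (r + 1) p [] = single p * cupProd x r (p + 1) [] := by
  rw [cupProd.eq_def]; simp [h]

theorem cupProd_cons_of_mem (h : p ∈ x) (c : ℕ) (st : List ℕ) :
    cupProd x (r + 1) p (c :: st) = cup c p * cupProd x r (p + 1) st := by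
  rw [cupProd.eq_def]; simp [h]

theorem cupProd_congr {y : Finset ℕ} (h : ∀ t, p ≤ t → (t ∈ x ↔ t ∈ y)) (st : List ℕ) :
    cupProd x r p st = cupProd y r p st := by
  induction r generalizing p st with
  | zero => simp [cupProd]
  | succ r ih =>
    have ih' := fun st => ih (p := p + 1) (fun t ht => h t (by omega)) st
    by_cases hp : p ∈ x
    · have hp' := (h p le_rfl).1 hp
      cases st with
      | nil => rw [cupProd_nil_of_mem hp, cupProd_nil_of_mem hp', ih']
      | cons c st => rw [cupProd_cons_of_mem hp, cupProd_cons_of_mem hp', ih']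
    · rw [cupProd_of_notMem hp, cupProd_of_notMem (fun h' => hp ((h p le_rfl).2 h')), ih']

theorem C_mem_supported (s : Set ℕ) (a : ℤ[T;T⁻¹]) :
    (C a : MvPolynomial ℕ ℤ[T;T⁻¹]) ∈ supported ℤ[T;T⁻¹] s := Subalgebra.algebraMap_mem _ a

theorem X_mem_supported' {s : Set ℕ} {a : ℕ} (h : a ∈ s) :
    (X a : MvPolynomial ℕ ℤ[T;T⁻¹]) ∈ supported ℤ[T;T⁻¹] s := X_mem_supported.2 h

theorem cup_mem_supported {s : Set ℕ} {c p : ℕ} (hc : c ∈ s) (hp : p ∈ s) :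
    cup c p ∈ supported ℤ[T;T⁻¹] s :=
  add_mem (X_mem_supported' hp) (mul_mem (C_mem_supported s _) (X_mem_supported' hc))

theorem single_mem_supported {s : Set ℕ} {p : ℕ} (hp : p ∈ s) :
    single p ∈ supported ℤ[T;T⁻¹] s := by
  rw [single]
  split_ifs
  · exact add_mem (X_mem_supported' hp) (one_mem _)
  · exact add_mem (X_mem_supported' hp) (C_mem_supported s _)

theorem cupProd_mem_supported {s : Set ℕ} {st : List ℕ} (hst : ∀ c ∈ st, c ∈ s)
    (hp : ∀ t, p ≤ t → t < p + r → t ∈ s) : cupProd x r p st ∈ supported ℤ[T;T⁻¹] s := by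
  induction r generalizing p st with
  | zero => simp [cupProd]
  | succ r ih =>
    have hp' : ∀ t, p + 1 ≤ t → t < p + 1 + r → t ∈ s := fun t h1 h2 => hp t (by omega) (by omega)
    have hps : p ∈ s := hp p le_rfl (by omega)
    by_cases h : p ∈ x
    · cases st with
      | nil =>
        rw [cupProd_nil_of_mem h]
        exact mul_mem (single_mem_supported hps) (ih (by simp) hp')
      | cons c st =>
        rw [cupProd_cons_of_mem h]
        exact mul_mem (cup_mem_supported (hst c (by simp)) hps)
          (ih (fun c hc => hst c (by simp [hc])) hp')
    · rw [cupProd_of_notMem h]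
      exact ih (by simpa using ⟨hps, hst⟩) hp'

/-- `cupProd` is affine in the variable of a position on the list. -/
theorem exists_cupProd_append_cons {s : Set ℕ} {pre st : List ℕ} (hpre : ∀ c ∈ pre, c ∈ s)
    (hst : ∀ c ∈ st, c ∈ s) (hp : ∀ t, p ≤ t → t < p + r → t ∈ s) :
    ∃ U ∈ supported ℤ[T;T⁻¹] s, ∃ V ∈ supported ℤ[T;T⁻¹] s,
      ∀ e, cupProd x r p (pre ++ e :: st) = U + V * X e := by
  induction r generalizing p pre with
  | zero => exact ⟨1, one_mem _, 0, zero_mem _, fun e => by simp [cupProd]⟩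
  | succ r ih =>
    have hp' : ∀ t, p + 1 ≤ t → t < p + 1 + r → t ∈ s := fun t h1 h2 => hp t (by omega) (by omega)
    have hps : p ∈ s := hp p le_rfl (by omega)
    by_cases h : p ∈ x
    · cases pre with
      | nil =>
        -- Here `p` is matched with `e`, and the factor `cup e p` is the only one that contains `X
        -- e`.
        have hF := cupProd_mem_supported (x := x) hst hp'
        refine ⟨_, mul_mem (X_mem_supported' hps) hF, _, mul_mem (C_mem_supported s (T 1)) hF,
          fun e => ?_⟩
        rw [List.nil_append, cupProd_cons_of_mem h, cup]
        ring
      | cons c pre =>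
        obtain ⟨U, hU, V, hV, e⟩ := ih (pre := pre) (fun c hc => hpre c (by simp [hc])) hp'
        have hc := cup_mem_supported (hpre c (by simp)) hps
        refine ⟨_, mul_mem hc hU, _, mul_mem hc hV, fun a => ?_⟩
        rw [List.cons_append, cupProd_cons_of_mem h, e]
        ring
    · obtain ⟨U, hU, V, hV, e⟩ := ih (pre := p :: pre) (by simpa using ⟨hps, hpre⟩) hp'
      refine ⟨U, hU, V, hV, fun a => ?_⟩
      rw [cupProd_of_notMem h, ← e, List.cons_append]

/-- The partner p' of the bottom entry e becomes unmatched when e is dropped, so X_{p'} + v X_e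
turns into X_{p'} + 1 or X_{p'} + v. This substitutes v⁻¹ or 1 for X_e. Each scanned position
changes the list length by one, so p + `pre.length` keeps its parity, which is the parity of p' once
the list above e is empty. -/
theorem exists_cupProd_append_singleton {s : Set ℕ} {pre : List ℕ} (hpre : ∀ c ∈ pre, c ∈ s)
    (hp : ∀ t, p ≤ t → t < p + r → t ∈ s) :
    ∃ U ∈ supported ℤ[T;T⁻¹] s, ∃ V ∈ supported ℤ[T;T⁻¹] s,
      (∀ e, cupProd x r p (pre ++ [e]) = U + V * X e) ∧
      cupProd x r p pre = U + C (if Even (p + pre.length) then T (-1) else 1) * V := by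
  induction r generalizing p pre with
  | zero => exact ⟨1, one_mem _, 0, zero_mem _, fun e => by simp [cupProd], by simp [cupProd]⟩
  | succ r ih =>
    have hp' : ∀ t, p + 1 ≤ t → t < p + 1 + r → t ∈ s := fun t h1 h2 => hp t (by omega) (by omega)
    have hps : p ∈ s := hp p le_rfl (by omega)
    by_cases h : p ∈ x
    · cases pre with
      | nil =>
        have hF := cupProd_mem_supported (x := x) (st := []) (by simp) hp'
        refine ⟨_, mul_mem (X_mem_supported' hps) hF, _, mul_mem (C_mem_supported s (T 1)) hF,
          fun e => ?_, ?_⟩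
        · rw [List.nil_append, cupProd_cons_of_mem h, cup]
          ring
        · rw [cupProd_nil_of_mem h, single, List.length_nil, add_zero, ← mul_assoc, ← C_mul,
            ← add_mul]
          split_ifs
          · rw [← LaurentPolynomial.T_add]; simp
          · rw [one_mul]
      | cons c pre =>
        obtain ⟨U, hU, V, hV, e, e'⟩ := ih (pre := pre) (fun c hc => hpre c (by simp [hc])) hp'
        have hc := cup_mem_supported (hpre c (by simp)) hps
        refine ⟨_, mul_mem hc hU, _, mul_mem hc hV, fun a => ?_, ?_⟩
        · rw [List.cons_append, cupProd_cons_of_mem h, e]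
          ring
        · rw [cupProd_cons_of_mem h, e', List.length_cons,
            show p + (pre.length + 1) = p + 1 + pre.length by ring]
          ring
    · obtain ⟨U, hU, V, hV, e, e'⟩ := ih (pre := p :: pre) (by simpa using ⟨hps, hpre⟩) hp'
      refine ⟨U, hU, V, hV, fun a => ?_, ?_⟩
      · rw [cupProd_of_notMem h, ← e, List.cons_append]
      · rw [cupProd_of_notMem h, e', List.length_cons]
        congr 4
        rw [show p + 1 + (pre.length + 1) = p + pre.length + 2 by ring, Nat.even_add]
        simp

variable {n : ℕ} {W : Type*} [Group W] (cs : CoxeterSystem (typeB n) W)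

theorem C_mul_C_inv : (C (T 1) * C (T (-1)) : MvPolynomial ℕ ℤ[T;T⁻¹]) = 1 := by
  rw [← C_mul, ← LaurentPolynomial.T_add]; simp

theorem act_cup {i : Fin n} (hi : i.1 ≠ 0) {c : ℕ} (hc : c ∈ farVars n i) :
    Act cs i (cup c i) (cup i (i + 1)) := by
  have h := (act_X cs hi).add (((act_one cs hi).mul_left (X_mem_supported' hc)).smul (T 1))
  rw [mul_one, mul_zero, mul_zero, add_zero] at h
  exact h

/-- Before the step i + 1 is waiting for a partner, afterwards c is. This rule and `act_cup` handle
the two terms of a product affine in X_{i+1}, and X_c takes the place of X_{i+1}. -/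
theorem act_cup_mul_X {i : Fin n} (hi : i.1 ≠ 0) {c : ℕ} (hc : c ∈ farVars n i) :
    Act cs i (cup c i * X (i.1 + 1)) (X c * cup i (i + 1)) := by
  have h := (act_X_mul_X cs hi).add
    (((act_X_succ cs hi).mul_left (X_mem_supported' hc)).smul (T 1))
  convert h using 1
  · rw [cup]; ring
  · rw [cup]; linear_combination (-X c * X (i.1 + 1)) * C_mul_C_inv

theorem act_single {i : Fin n} (hi : i.1 ≠ 0) : Act cs i (single i) (cup i (i + 1)) := by
  rw [single]
  split_ifs
  · have h := (act_X cs hi).add (act_one cs hi)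
    rwa [add_zero] at h
  · have h := (act_X cs hi).add ((act_one cs hi).smul (T 1))
    rwa [mul_one, mul_zero, add_zero] at h

/-- The partner of i + 1, if any, becomes unmatched because i + 1 is now matched with i. The scalar
is the substitution for X_{i+1} in `exists_cupProd_append_singleton`. -/
theorem act_single_mul_X {i : Fin n} (hi : i.1 ≠ 0) : Act cs i (single i * X (i.1 + 1))
    (C (if Even i.1 then T (-1) else 1) * cup i (i + 1)) := by
  rw [single]
  split_ifs
  · have h := (act_X_mul_X cs hi).add (act_X_succ cs hi)
    convert h using 1
    · ring
    · rw [cup]; linear_combination (X i.1) * C_mul_C_inv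
  · have h := (act_X_mul_X cs hi).add ((act_X_succ cs hi).smul (T 1))
    convert h using 1
    · ring
    · rw [cup, C_1]; linear_combination (-X (i.1 + 1)) * C_mul_C_inv

/-- Write the product as U + V X_1. Then b_{s_0} sends it to U (X_1 + v) + V (1 + v⁻¹ X_1) = (X_1 +
v)(U + v⁻¹ V), where X_1 + v belongs to the new unmatched element 1 and the partner of 1, if any,
has become unmatched. -/
theorem act_cupProd_zero {i : Fin n} (hi : i.1 = 0) (hx : 1 ∉ x) :
    Act cs i (cupProd x n 1 []) (cupProd (step 0 x) n 1 []) := by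
  obtain ⟨m, rfl⟩ : ∃ m, n = m + 1 := ⟨n - 1, by have := i.2; omega⟩
  have h1 : 1 ∈ step 0 x := by rw [mem_step_zero]; simpa using hx
  rw [cupProd_of_notMem hx, cupProd_nil_of_mem h1,
    cupProd_congr (x := step 0 x) (y := x) (fun t ht => by rw [mem_step_zero, if_neg (by omega)])]
  obtain ⟨U, hU, V, hV, e, e'⟩ := exists_cupProd_append_singleton (x := x) (r := m) (p := 1 + 1)
    (s := farVars (m + 1) i) (pre := []) (by simp)
    (fun t h1 h2 => ⟨Finset.mem_Icc.2 (by omega), by omega, by omega⟩)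
  have h := ((act_zero_one cs hi).mul_left hU).add ((act_zero_X cs hi).mul_left hV)
  rw [show [1] = [] ++ [1] from rfl, e, e', single]
  convert h using 1
  · ring
  · simp; linear_combination V * C_mul_C_inv

/-- After the step i and i + 1 form a pair, and i + 1 no longer waits for a partner: the former
partner c of i takes over that role, or nobody does if i was unmatched. The tail of the product is
affine in the variable concerned, so the local rules suffice. -/
theorem act_cupProd_pos {i : Fin n} (hi : i.1 ≠ 0) (hx : IsUp i x) {st : List ℕ}
    (hst : ∀ c ∈ st, 1 ≤ c ∧ c < i.1) :
    Act cs i (cupProd x (n + 1 - i) i st) (cupProd (step i x) (n + 1 - i) i st) := by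
  have hin := i.2
  obtain ⟨m, hm⟩ : ∃ m, n = i + 1 + m := Nat.exists_eq_add_of_le hin
  have hix : i.1 ∈ x := hx.1.resolve_left hi
  have h1 : i.1 ∉ step i x := by
    rw [mem_step_pos hi, Equiv.swap_apply_left]; exact hx.2
  have h2 : i.1 + 1 ∈ step i x := by
    rw [mem_step_pos hi, Equiv.swap_apply_right]; exact hix
  have hcongr (st : List ℕ) : cupProd (step i x) m (i + 1 + 1) st = cupProd x m (i + 1 + 1) st :=
    cupProd_congr (fun t ht => by
      rw [mem_step_pos hi, Equiv.swap_apply_of_ne_of_ne (by omega) (by omega)]) st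
  have hs : ∀ c ∈ st, c ∈ farVars n i := fun c hc => by
    have := hst c hc
    exact ⟨Finset.mem_Icc.2 (by omega), by omega, by omega⟩
  have hs' : ∀ t, i.1 + 1 + 1 ≤ t → t < i.1 + 1 + 1 + m → t ∈ farVars n i :=
    fun t h1 h2 => ⟨Finset.mem_Icc.2 (by omega), by omega, by omega⟩
  rw [show n + 1 - i = m + 1 + 1 by omega, cupProd_of_notMem h1, cupProd_cons_of_mem h2, hcongr]
  cases st with
  | nil =>
    rw [cupProd_nil_of_mem hix, cupProd_of_notMem hx.2]
    obtain ⟨U, hU, V, hV, e, e'⟩ := exists_cupProd_append_singleton (x := x) (r := m)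
      (p := i.1 + 1 + 1) (s := farVars n i) (pre := []) (by simp) hs'
    have h := ((act_single cs hi).mul_left hU).add ((act_single_mul_X cs hi).mul_left hV)
    have hpar : Even (i.1 + 1 + 1 + ([] : List ℕ).length) ↔ Even i.1 := by
      rw [List.length_nil, add_zero, add_assoc, Nat.even_add]; simp
    rw [if_congr hpar rfl rfl] at e'
    rw [show [i.1 + 1] = [] ++ [i.1 + 1] from rfl, e, e']
    convert h using 1 <;> ring
  | cons c st =>
    rw [cupProd_cons_of_mem hix, cupProd_of_notMem hx.2]
    obtain ⟨U, hU, V, hV, e⟩ := exists_cupProd_append_cons (x := x) (r := m)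
      (p := i.1 + 1 + 1) (s := farVars n i) (pre := []) (st := st) (by simp)
      (fun c hc => hs c (by simp [hc])) hs'
    have hc := hs c (by simp)
    have h := ((act_cup cs hi hc).mul_left hU).add ((act_cup_mul_X cs hi hc).mul_left hV)
    simp only [List.nil_append] at e
    rw [e, e]
    convert h using 1 <;> ring

theorem act_cupProd {i : Fin n} (hx : IsUp i x) :
    Act cs i (cupProd x n 1 []) (cupProd (step i x) n 1 []) := by
  rcases eq_or_ne i.1 0 with hi | hi
  · have := act_cupProd_zero cs hi (x := x) (by simpa [IsUp, hi] using hx)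
    rwa [← hi] at this
  have hin := i.2
  -- Induction on the distance `k` from `p` to `i`: factors completed before position `i` involve
  -- only far variables and can be pulled out.
  have key : ∀ k p st, p + k = i.1 → 1 ≤ p → (∀ c ∈ st, 1 ≤ c ∧ c < p) →
      Act cs i (cupProd x (n + 1 - p) p st) (cupProd (step i x) (n + 1 - p) p st) := by
    intro k
    induction k with
    | zero =>
      intro p st hp h1 hst
      obtain rfl : p = i.1 := by omega
      exact act_cupProd_pos cs hi hx hst
    | succ k ih =>
      intro p st hp h1 hst
      have hpi : p ∈ step i x ↔ p ∈ x := by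
        rw [mem_step_pos hi, Equiv.swap_apply_of_ne_of_ne (by omega) (by omega)]
      have ih' := fun st => ih (p + 1) st (by omega) (by omega)
      have hps : p ∈ farVars n i := ⟨Finset.mem_Icc.2 (by omega), by omega, by omega⟩
      rw [show n + 1 - p = n + 1 - (p + 1) + 1 by omega]
      by_cases h : p ∈ x
      · have h' := hpi.2 h
        cases st with
        | nil =>
          rw [cupProd_nil_of_mem h, cupProd_nil_of_mem h']
          exact (ih' [] (by simp)).mul_left (single_mem_supported hps)
        | cons c st =>
          rw [cupProd_cons_of_mem h, cupProd_cons_of_mem h']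
          have hc := hst c (by simp)
          refine (ih' st fun c hc => ?_).mul_left (cup_mem_supported
            ⟨Finset.mem_Icc.2 (by omega), by omega, by omega⟩ hps)
          have := hst c (by simp [hc])
          omega
      · rw [cupProd_of_notMem h, cupProd_of_notMem (fun h' => h (hpi.1 h'))]
        refine ih' _ fun c hc => ?_
        rcases List.mem_cons.1 hc with rfl | hc
        · omega
        · have := hst c hc
          omega
  have := key (i.1 - 1) 1 [] (by omega) le_rfl (by simp)
  simpa using this

theorem cupProd_empty (r p : ℕ) (st : List ℕ) : cupProd ∅ r p st = 1 := by
  induction r generalizing p st with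
  | zero => simp [cupProd]
  | succ r ih => rw [cupProd_of_notMem (by simp), ih]

theorem stdElt_empty : stdElt cs ∅ = oneTensor cs _ 1 := by
  rw [stdElt_eq, ofSubset_val cs (by simp)]
  simp [rowExpr, δ_one]

/-- The Bott–Samelson element of a reduced expression of `x` is the product of the factors
attached to `x`. -/
theorem stdElt_smul_bWord {ω : List (Fin n)} (hω : cs.IsReduced ω)
    (h : ∀ u ∈ parabolic cs (typeA n), cs.length (cs.wordProd ω) ≤ cs.length (u * cs.wordProd ω)) :
    stdElt cs ∅ <• bWord cs ω = ofPoly cs (cupProd (subsetOf cs (cs.wordProd ω)) n 1 []) := by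
  induction ω using List.reverseRecOn with
  | nil =>
    rw [cs.wordProd_nil, subsetOf_one, cupProd_empty]
    have h1 := ofPoly_monomial cs 0
    simp only [monomial_zero', C_1, Finsupp.support_zero] at h1
    simp [bWord, h1]
  | append_singleton ω i ih =>
    have h1 : cs.IsReduced ω := by simpa using hω.take ω.length
    have e : cs.wordProd (ω ++ [i]) = cs.wordProd ω * cs.simple i := by
      simp [cs.wordProd_append]
    have hl : cs.length (cs.wordProd ω * cs.simple i) = cs.length (cs.wordProd ω) + 1 := by
      rw [← e, hω.eq, h1.eq]; simp
    rw [e] at h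
    have hup := isUp_of_minimal cs hl h
    have e2 : bWord cs (ω ++ [i]) = bWord cs ω * b cs i := by simp [bWord]
    rw [e, e2, subsetOf_mul_simple, MulOpposite.op_mul, mul_smul,
      ih h1 (minimal_of_mul_simple cs hl h)]
    have := act_cupProd cs hup 1 (one_mem _)
    rwa [one_mul, one_mul] at this

end Diagram

/-! ### Expansion of the Bott–Samelson product over even unmatched elements -/

section KLPolynomial

open LaurentPolynomial (T)
open MvPolynomial

/-- Like `cupProd`, but with the factors of the Kazhdan–Lusztig basis: from the second one on, the
unmatched elements of `x` are joined in pairs. The last argument holds the unmatched element that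
waits for a partner. -/
def klProd (x : Finset ℕ) : ℕ → ℕ → List ℕ → Option ℕ → MvPolynomial ℕ ℤ[T;T⁻¹]
  | 0, _, _, none => 1
  | 0, _, _, some a => X a
  | r + 1, p, st, q => if p ∈ x then
      match st, q with
      | c :: st, q => cup c p * klProd x r (p + 1) st q
      | [], some a => (X a * X p + C (T 1)) * klProd x r (p + 1) [] none
      | [], none => if Even p then klProd x r (p + 1) [] (some p)
        else (X p + C (T 1)) * klProd x r (p + 1) [] none
    else klProd x r (p + 1) (p :: st) q

variable {x : Finset ℕ} {r p : ℕ}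

theorem klProd_of_notMem (h : p ∉ x) (st : List ℕ) (q : Option ℕ) :
    klProd x (r + 1) p st q = klProd x r (p + 1) (p :: st) q := by
  rw [klProd.eq_def]; simp [h]

theorem klProd_cons_of_mem (h : p ∈ x) (c : ℕ) (st : List ℕ) (q : Option ℕ) :
    klProd x (r + 1) p (c :: st) q = cup c p * klProd x r (p + 1) st q := by
  rw [klProd.eq_def]; simp [h]

theorem klProd_nil_some_of_mem (h : p ∈ x) (a : ℕ) :
    klProd x (r + 1) p [] (some a) = (X a * X p + C (T 1)) * klProd x r (p + 1) [] none := by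
  rw [klProd.eq_def]; simp [h]

theorem klProd_nil_none_of_even (h : p ∈ x) (hp : Even p) :
    klProd x (r + 1) p [] none = klProd x r (p + 1) [] (some p) := by
  rw [klProd.eq_def]; simp [h, hp]

theorem klProd_nil_none_of_not_even (h : p ∈ x) (hp : ¬ Even p) :
    klProd x (r + 1) p [] none = (X p + C (T 1)) * klProd x r (p + 1) [] none := by
  rw [klProd.eq_def]; simp [h, hp]

theorem klProd_congr {y : Finset ℕ} (h : ∀ t, p ≤ t → (t ∈ x ↔ t ∈ y)) (st : List ℕ)
    (q : Option ℕ) : klProd x r p st q = klProd y r p st q := by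
  induction r generalizing p st q with
  | zero => cases q <;> simp [klProd]
  | succ r ih =>
    have ih' := fun st => ih (p := p + 1) (fun t ht => h t (by omega)) st
    rw [klProd.eq_def x, klProd.eq_def y]
    simp only [h p le_rfl, ih']

/-- The even unmatched elements found by the scan that defines `cupProd`. -/
def evenUnmatched (x : Finset ℕ) : ℕ → ℕ → List ℕ → Finset ℕ
  | 0, _, _ => ∅
  | r + 1, p, st => if p ∈ x then
      match st with
      | [] => if Even p then insert p (evenUnmatched x r (p + 1) [])
        else evenUnmatched x r (p + 1) []
      | _ :: st => evenUnmatched x r (p + 1) st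
    else evenUnmatched x r (p + 1) (p :: st)

theorem evenUnmatched_of_notMem (h : p ∉ x) (st : List ℕ) :
    evenUnmatched x (r + 1) p st = evenUnmatched x r (p + 1) (p :: st) := by
  rw [evenUnmatched.eq_def]; simp [h]

theorem evenUnmatched_cons_of_mem (h : p ∈ x) (c : ℕ) (st : List ℕ) :
    evenUnmatched x (r + 1) p (c :: st) = evenUnmatched x r (p + 1) st := by
  rw [evenUnmatched.eq_def]; simp [h]

theorem evenUnmatched_nil_of_even (h : p ∈ x) (hp : Even p) :
    evenUnmatched x (r + 1) p [] = insert p (evenUnmatched x r (p + 1) []) := by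
  rw [evenUnmatched.eq_def]; simp [h, hp]

theorem evenUnmatched_nil_of_not_even (h : p ∈ x) (hp : ¬ Even p) :
    evenUnmatched x (r + 1) p [] = evenUnmatched x r (p + 1) [] := by
  rw [evenUnmatched.eq_def]; simp [h, hp]

theorem card_Ico_sdiff_succ {p t : ℕ} (h : p < t) : (Finset.Ico p t \ x).card =
    (Finset.Ico (p + 1) t \ x).card + if p ∈ x then 0 else 1 := by
  rw [← Finset.insert_Ico_add_one_left_eq_Ico h]
  split_ifs with hp
  · rw [Finset.insert_sdiff_of_mem _ hp, add_zero]
  · rw [Finset.insert_sdiff_of_notMem _ hp, Finset.card_insert_of_notMem (by simp)]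

theorem card_Ico_inter_succ {p t : ℕ} (h : p < t) : (Finset.Ico p t ∩ x).card =
    (Finset.Ico (p + 1) t ∩ x).card + if p ∈ x then 1 else 0 := by
  rw [← Finset.insert_Ico_add_one_left_eq_Ico h]
  split_ifs with hp
  · rw [Finset.insert_inter_of_mem hp, Finset.card_insert_of_notMem (by simp)]
  · rw [Finset.insert_inter_of_notMem hp, add_zero]

/-- The ballot criterion: t ∈ x is unmatched when, looking left from t, opening positions never
outnumber closing ones. The last condition does the same for the entries of `st`, which lie to the
left of p. -/
theorem mem_evenUnmatched {t : ℕ} {st : List ℕ} : t ∈ evenUnmatched x r p st ↔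
    (p ≤ t ∧ t < p + r) ∧ t ∈ x ∧ Even t ∧
      (∀ k, p ≤ k → (Finset.Ico k t \ x).card ≤ (Finset.Ico k t ∩ x).card) ∧
      st.length + (Finset.Ico p t \ x).card ≤ (Finset.Ico p t ∩ x).card := by
  induction r generalizing p st with
  | zero => simp only [evenUnmatched, Finset.notMem_empty, false_iff]; omega
  | succ r ih =>
    rcases lt_trichotomy t p with hlt | rfl | hlt
    · have h0 (st) : t ∉ evenUnmatched x r (p + 1) st := by rw [ih]; omega
      have h1 : t ∉ evenUnmatched x (r + 1) p st := by
        by_cases hp : p ∈ x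
        · cases st with
          | nil =>
            by_cases hev : Even p
            · rw [evenUnmatched_nil_of_even hp hev, Finset.mem_insert]
              simp [h0]; omega
            · rw [evenUnmatched_nil_of_not_even hp hev]; exact h0 _
          | cons c st => rw [evenUnmatched_cons_of_mem hp]; exact h0 _
        · rw [evenUnmatched_of_notMem hp]; exact h0 _
      simp only [h1, false_iff]; omega
    · have h0 (st) : t ∉ evenUnmatched x r (t + 1) st := by rw [ih]; omega
      have hk : ∀ k, t ≤ k → (Finset.Ico k t \ x).card ≤ (Finset.Ico k t ∩ x).card := by
        intro k hk; rw [Finset.Ico_eq_empty (by omega)]; simp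
      by_cases hp : t ∈ x
      · cases st with
        | nil =>
          by_cases hev : Even t
          · rw [evenUnmatched_nil_of_even hp hev]
            simpa [hev, hp] using hk
          · rw [evenUnmatched_nil_of_not_even hp hev]
            simp [hev, h0]
        | cons c st => rw [evenUnmatched_cons_of_mem hp]; simp [h0]
      · rw [evenUnmatched_of_notMem hp]; simp [h0, hp]
    · have hall : (∀ k, p ≤ k → (Finset.Ico k t \ x).card ≤ (Finset.Ico k t ∩ x).card) ↔
          (Finset.Ico p t \ x).card ≤ (Finset.Ico p t ∩ x).card ∧
          ∀ k, p + 1 ≤ k → (Finset.Ico k t \ x).card ≤ (Finset.Ico k t ∩ x).card := by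
        refine ⟨fun h => ⟨h p le_rfl, fun k hk => h k (by omega)⟩, fun h k hk => ?_⟩
        rcases hk.eq_or_lt with rfl | hk
        · exact h.1
        · exact h.2 k hk
      have hr : (p + 1 ≤ t ∧ t < p + 1 + r) ↔ (p ≤ t ∧ t < p + (r + 1)) := by omega
      rw [hall, card_Ico_sdiff_succ hlt, card_Ico_inter_succ hlt]
      by_cases hp : p ∈ x
      · cases st with
        | nil =>
          have e : t ∈ evenUnmatched x (r + 1) p [] ↔ t ∈ evenUnmatched x r (p + 1) [] := by
            by_cases hev : Even p
            · rw [evenUnmatched_nil_of_even hp hev, Finset.mem_insert]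
              simp [hlt.ne']
            · rw [evenUnmatched_nil_of_not_even hp hev]
          rw [e, ih, hr]
          simp only [hp, if_true, List.length_nil]
          refine and_congr_right fun _ => and_congr_right fun _ => and_congr_right fun _ => ?_
          constructor
          · rintro ⟨h1, h2⟩; exact ⟨⟨by omega, h1⟩, by omega⟩
          · rintro ⟨⟨-, h1⟩, -⟩; have := h1 (p + 1) le_rfl; exact ⟨h1, by omega⟩
        | cons c st =>
          rw [evenUnmatched_cons_of_mem hp, ih, hr]
          simp only [hp, if_true, List.length_cons]
          refine and_congr_right fun _ => and_congr_right fun _ => and_congr_right fun _ => ?_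
          constructor
          · rintro ⟨h1, h2⟩; exact ⟨⟨by omega, h1⟩, by omega⟩
          · rintro ⟨⟨-, h1⟩, h2⟩; exact ⟨h1, by omega⟩
      · rw [evenUnmatched_of_notMem hp, ih, hr]
        simp only [hp, if_false, List.length_cons]
        refine and_congr_right fun _ => and_congr_right fun _ => and_congr_right fun _ => ?_
        constructor
        · rintro ⟨h1, h2⟩; exact ⟨⟨by omega, h1⟩, by omega⟩
        · rintro ⟨⟨-, h1⟩, h2⟩; exact ⟨h1, by omega⟩

/-- Including t ∈ x itself in the interval turns the weak ballot inequality into the strict one that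
defines E(x). -/
theorem evenUnmatched_eq_defectSet {n : ℕ} (hx : x ⊆ Finset.Icc 1 n) :
    evenUnmatched x n 1 [] = defectSet x := by
  ext t
  rw [mem_evenUnmatched, defectSet, Finset.mem_filter, InDefectSet]
  have key : t ∈ x → ∀ k ≤ t, ((Finset.Icc k t \ x).card < (Finset.Icc k t ∩ x).card ↔
      (Finset.Ico k t \ x).card ≤ (Finset.Ico k t ∩ x).card) := by
    intro ht k hk
    rw [← Finset.Ico_insert_right hk, Finset.insert_sdiff_of_mem _ ht,
      Finset.insert_inter_of_mem ht, Finset.card_insert_of_notMem (by simp)]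
    omega
  constructor
  · rintro ⟨-, ht, hev, h, -⟩
    refine ⟨ht, hev, fun k hk => ?_⟩
    rw [Finset.mem_Ico] at hk
    rw [key ht k hk.2.le]
    exact h k hk.1
  · rintro ⟨ht, hev, h⟩
    have ht' := Finset.mem_Icc.1 (hx ht)
    have h' : ∀ k, 1 ≤ k → (Finset.Ico k t \ x).card ≤ (Finset.Ico k t ∩ x).card := by
      intro k hk
      rcases lt_or_ge k t with hkt | hkt
      · rw [← key ht k hkt.le]; exact h k (Finset.mem_Ico.2 ⟨hk, hkt⟩)
      · rw [Finset.Ico_eq_empty (by omega)]; simp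
    exact ⟨by omega, ht, hev, h', by simpa using h' 1 le_rfl⟩

theorem le_of_mem_evenUnmatched {t : ℕ} {st : List ℕ} (h : t ∈ evenUnmatched x r p st) : p ≤ t :=
  (mem_evenUnmatched.1 h).1.1

theorem mem_sdiff_of_subset_evenUnmatched {E : Finset ℕ} {st : List ℕ}
    (hE : E ∈ (evenUnmatched x r (p + 1) st).powerset) : p ∈ x \ E ↔ p ∈ x := by
  rw [Finset.mem_sdiff, and_iff_left]
  intro h
  have := le_of_mem_evenUnmatched (Finset.mem_powerset.1 hE h)
  omega

/-- An even unmatched a either stays and waits for a partner, or is removed and becomes the bottom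
entry of the list. The two options merge at the next unmatched p, which is odd by the parity
condition: (X_a X_p + v) + (X_p + v X_a) = (X_a + 1)(X_p + v). If there is no such p, they
contribute X_a and 1. -/
theorem X_add_one_mul_cupProd_of {a : ℕ} {pre : List ℕ} (hpar : ¬ Even (p + pre.length))
    (ih : ∀ r' < r, ∀ p', cupProd x r' p' [] =
      ∑ E ∈ (evenUnmatched x r' p' []).powerset, klProd (x \ E) r' p' [] none) :
    (X a + 1) * cupProd x r p pre = ∑ E ∈ (evenUnmatched x r p pre).powerset,
      (klProd (x \ E) r p pre (some a) + klProd (x \ E) r p (pre ++ [a]) none) := by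
  induction r generalizing p pre with
  | zero => simp [cupProd, klProd, evenUnmatched]
  | succ r ihr =>
    have ihr' := fun p pre h => ihr (p := p) (pre := pre) h fun r' hr' => ih r' (by omega)
    by_cases hp : p ∈ x
    · cases pre with
      | nil =>
        have hodd : ¬ Even p := by simpa using hpar
        rw [cupProd_nil_of_mem hp, evenUnmatched_nil_of_not_even hp hodd, ih r (by omega) (p + 1),
          Finset.mul_sum, Finset.mul_sum]
        refine Finset.sum_congr rfl fun E hE => ?_
        have hpE := (mem_sdiff_of_subset_evenUnmatched hE).2 hp
        rw [klProd_nil_some_of_mem hpE, List.nil_append, klProd_cons_of_mem hpE, single,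
          if_neg hodd, cup]
        ring
      | cons c pre =>
        rw [cupProd_cons_of_mem hp, evenUnmatched_cons_of_mem hp, mul_left_comm, ihr',
          Finset.mul_sum]
        · refine Finset.sum_congr rfl fun E hE => ?_
          have hpE := (mem_sdiff_of_subset_evenUnmatched hE).2 hp
          rw [klProd_cons_of_mem hpE, List.cons_append, klProd_cons_of_mem hpE]
          ring
        · rwa [List.length_cons, ← add_assoc, add_right_comm] at hpar
    · rw [cupProd_of_notMem hp, evenUnmatched_of_notMem hp, ihr']
      · refine Finset.sum_congr rfl fun E hE => ?_
        have hpE := fun h => hp ((mem_sdiff_of_subset_evenUnmatched hE).1 h)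
        rw [klProd_of_notMem hpE, klProd_of_notMem hpE, List.cons_append]
      · rw [List.length_cons, show p + 1 + (pre.length + 1) = p + pre.length + 2 by ring,
          Nat.even_add]
        simpa using hpar

theorem cupProd_eq_sum (x : Finset ℕ) (r p : ℕ) (st : List ℕ) : cupProd x r p st =
    ∑ E ∈ (evenUnmatched x r p st).powerset, klProd (x \ E) r p st none := by
  induction r using Nat.strong_induction_on generalizing p st with
  | _ r ih =>
  cases r with
  | zero => simp [cupProd, klProd, evenUnmatched]
  | succ r =>
    by_cases hp : p ∈ x
    · cases st with
      | nil =>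
        by_cases hev : Even p
        · have hnot : p ∉ evenUnmatched x r (p + 1) [] := fun h => by
            have := le_of_mem_evenUnmatched h; omega
          -- Subsets are split by whether they contain `p`: if not, `p` waits for a partner; if so,
          -- `p` is pushed on the list.
          rw [cupProd_nil_of_mem hp, evenUnmatched_nil_of_even hp hev,
            Finset.sum_powerset_insert hnot, ← Finset.sum_add_distrib, single, if_pos hev,
            X_add_one_mul_cupProd_of (by simpa [Nat.even_add_one] using hev)
              (fun r' hr' p' => ih r' (by omega) p' [])]
          refine Finset.sum_congr rfl fun E hE => ?_
          have hpE := (mem_sdiff_of_subset_evenUnmatched hE).2 hp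
          rw [klProd_nil_none_of_even hpE hev, klProd_of_notMem (x := x \ insert p E) (by simp),
            List.nil_append, klProd_congr (x := x \ insert p E) (y := x \ E)]
          intro t ht
          have : t ≠ p := by omega
          simp [this]
        · rw [cupProd_nil_of_mem hp, evenUnmatched_nil_of_not_even hp hev, ih r (by omega),
            Finset.mul_sum]
          refine Finset.sum_congr rfl fun E hE => ?_
          have hpE := (mem_sdiff_of_subset_evenUnmatched hE).2 hp
          rw [klProd_nil_none_of_not_even hpE hev, single, if_neg hev]
      | cons c st =>
        rw [cupProd_cons_of_mem hp, evenUnmatched_cons_of_mem hp, ih r (by omega),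
          Finset.mul_sum]
        refine Finset.sum_congr rfl fun E hE => ?_
        have hpE := (mem_sdiff_of_subset_evenUnmatched hE).2 hp
        rw [klProd_cons_of_mem hpE]
    · rw [cupProd_of_notMem hp, evenUnmatched_of_notMem hp, ih r (by omega)]
      refine Finset.sum_congr rfl fun E hE => ?_
      have hpE := fun h => hp ((mem_sdiff_of_subset_evenUnmatched hE).1 h)
      rw [klProd_of_notMem hpE]

end KLPolynomial

/-! ### Raising subsets in the Bruhat order -/

section Lower

/-- The Bruhat order on subsets of `{1, …, n}`: `x` is obtained from `y` by simple reflections,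
each of which increases the subset. -/
def Lower (n : ℕ) : Finset ℕ → Finset ℕ → Prop :=
  Relation.TransGen fun y x => ∃ i < n, y ⊆ Finset.Icc 1 n ∧ IsUp i y ∧ x = step i y

variable {n : ℕ} {w : Finset ℕ}

theorem lower_insert_one (hw : w ⊆ Finset.Icc 1 n) (hn : 1 ≤ n) (h : 1 ∉ w) :
    Lower n w (insert 1 w) := by
  have hup : IsUp 0 w := ⟨Or.inl rfl, h⟩
  have h0 := zero_notMem_of_subset_Icc hw
  refine .single ⟨0, hn, hw, hup, ?_⟩
  rw [step_eq_of_isUp hup h0, Finset.erase_eq_of_notMem h0]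

theorem lower_insert_succ (hw : w ⊆ Finset.Icc 1 n) {b : ℕ} (hb : 1 ≤ b) (hbn : b + 1 ≤ n)
    (h : b ∉ w) (h' : b + 1 ∉ w) : Lower n (insert b w) (insert (b + 1) w) := by
  have hup : IsUp b (insert b w) := ⟨Or.inr (Finset.mem_insert_self _ _), by simp [h']⟩
  have hs : insert b w ⊆ Finset.Icc 1 n :=
    Finset.insert_subset (Finset.mem_Icc.2 (by omega)) hw
  refine .single ⟨b, hbn, hs, hup, ?_⟩
  rw [step_eq_of_isUp hup (zero_notMem_of_subset_Icc hs), Finset.erase_insert h]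

/-- The element is raised one position at a time. When the way to b + 1 is blocked by b ∈ w, first b
moves to b + 1, then a moves to b. -/
theorem lower_insert_insert (hw : w ⊆ Finset.Icc 1 n) {a b : ℕ} (ha : 1 ≤ a) (hab : a < b)
    (hb : b ≤ n) (h : a ∉ w) (h' : b ∉ w) : Lower n (insert a w) (insert b w) := by
  induction b, hab using Nat.le_induction generalizing w with
  | base => exact lower_insert_succ hw ha hb h h'
  | succ b hab ih =>
    have hab : a < b := hab
    by_cases hbw : b ∈ w
    · obtain ⟨w, hbw, rfl⟩ : ∃ v, b ∉ v ∧ w = insert b v :=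
        ⟨w.erase b, by simp, (Finset.insert_erase hbw).symm⟩
      simp only [Finset.mem_insert, not_or] at h h'
      have hw' : w ⊆ Finset.Icc 1 n := (Finset.subset_insert _ _).trans hw
      have h1 := lower_insert_succ (w := insert a w)
        (Finset.insert_subset (Finset.mem_Icc.2 (by omega)) hw') (by omega) hb
        (by simp only [Finset.mem_insert]; grind) (by simp only [Finset.mem_insert]; grind)
      have h2 := ih (w := insert (b + 1) w)
        (Finset.insert_subset (Finset.mem_Icc.2 (by omega)) hw') (by omega)
        (by simp only [Finset.mem_insert]; grind) (by simp only [Finset.mem_insert]; grind)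
      rw [Finset.insert_comm a b, Finset.insert_comm (b + 1) b]
      rw [Finset.insert_comm (b + 1) a] at h1
      exact h1.trans h2
    · exact (ih hw (by omega) h hbw).trans (lower_insert_succ hw (by omega) hb hbw h')

/-- New elements enter only at 1. If 1 is free, insert it and raise it to b; if not, raise the old 1
to b and insert a new 1. -/
theorem lower_insert (hw : w ⊆ Finset.Icc 1 n) {b : ℕ} (hb1 : 1 ≤ b) (hb : b ≤ n)
    (h : b ∉ w) : Lower n w (insert b w) := by
  by_cases h1 : 1 ∈ w
  · have hb1 : 1 < b := lt_of_le_of_ne hb1 (by rintro rfl; exact h h1)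
    have e : insert b w = insert 1 (insert b (w.erase 1)) := by
      rw [Finset.insert_comm, Finset.insert_erase h1]
    have hw' : w.erase 1 ⊆ Finset.Icc 1 n := (Finset.erase_subset _ _).trans hw
    rw [e]
    nth_rw 1 [← Finset.insert_erase h1]
    refine (lower_insert_insert hw' le_rfl hb1 hb (by simp) (by simp [h])).trans
      (lower_insert_one ?_ (by omega) ?_)
    · exact Finset.insert_subset (Finset.mem_Icc.2 (by omega)) hw'
    · simp only [Finset.mem_insert, Finset.mem_erase]; grind
  · have h2 := lower_insert_one hw (by omega) h1
    rcases hb1.eq_or_lt with rfl | hb1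
    · exact h2
    · exact h2.trans (lower_insert_insert hw le_rfl hb1 hb h1 h)

theorem Lower.bruhatLT {W : Type*} [Group W] (cs : CoxeterSystem (typeB n) W) {x y : Finset ℕ}
    (h : Lower n y x) : BruhatLT cs (ofSubset cs y).1 (ofSubset cs x).1 := by
  refine Relation.TransGen.lift (fun x => (ofSubset cs x).1) ?_ _ _ h
  rintro y _ ⟨i, hi, hy, hup, rfl⟩
  refine ⟨cs.simple ⟨i, hi⟩, cs.isReflection_simple _,
    (ofSubset_mul_simple cs hy (i := ⟨i, hi⟩) hup).symm, ?_⟩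
  rw [length_ofSubset cs hy, length_ofSubset cs (step_subset_Icc hi hy),
    sum_step_of_isUp hup (zero_notMem_of_subset_Icc hy)]
  exact Nat.lt_succ_self _

end Lower

/-! ### Triangularity, self-duality, and the Kazhdan–Lusztig basis -/

section Triangular

open LaurentPolynomial (T)
open MvPolynomial

/-- The monomial of a set of variables. -/
def setMonomial (z : Finset ℕ) : MvPolynomial ℕ ℤ[T;T⁻¹] := ∏ a ∈ z, X a

theorem setMonomial_insert {a : ℕ} {z : Finset ℕ} (h : a ∉ z) :
    setMonomial (insert a z) = X a * setMonomial z := Finset.prod_insert h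

/-- `P` lies in `X ^ x + ∑ v ℤ[v] X ^ y`, where `y` runs over the sets lower than `x`. -/
def IsTriangular (n : ℕ) (x : Finset ℕ) (P : MvPolynomial ℕ ℤ[T;T⁻¹]) : Prop :=
  P - setMonomial x ∈ AddSubgroup.closure
    {m | ∃ (y : Finset ℕ) (k : ℕ), Lower n y x ∧ 1 ≤ k ∧ m = C (T k) * setMonomial y}

variable {n : ℕ}

theorem isTriangular_setMonomial (x : Finset ℕ) : IsTriangular n x (setMonomial x) := by
  rw [IsTriangular, sub_self]; exact zero_mem _

theorem mul_mem_closure {R : Type*} [CommRing R] {s t : Set R} {c a : R}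
    (h : ∀ m ∈ s, c * m ∈ AddSubgroup.closure t) (ha : a ∈ AddSubgroup.closure s) :
    c * a ∈ AddSubgroup.closure t :=
  (AddSubgroup.closure_le ((AddSubgroup.closure t).comap (AddMonoidHom.mulLeft c))).2 h ha

theorem IsTriangular.add {x y : Finset ℕ} {P Q : MvPolynomial ℕ ℤ[T;T⁻¹]}
    (hP : IsTriangular n x P) (hQ : IsTriangular n y Q) (h : Lower n y x) :
    IsTriangular n x (P + C (T 1) * Q) := by
  rw [IsTriangular, show P + C (T 1) * Q - setMonomial x = (P - setMonomial x) +
    (C (T 1) * (Q - setMonomial y) + C (T 1) * setMonomial y) by ring]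
  refine add_mem hP (add_mem ?_ (AddSubgroup.subset_closure ⟨y, 1, h, le_rfl, by simp⟩))
  refine mul_mem_closure ?_ hQ
  rintro _ ⟨z, k, hz, hk, rfl⟩
  refine AddSubgroup.subset_closure ⟨z, k + 1, hz.trans h, by omega, ?_⟩
  rw [← mul_assoc, ← C_mul, ← LaurentPolynomial.T_add, add_comm, Nat.cast_succ]

theorem inter_Ico_of_mem {x : Finset ℕ} {r p : ℕ} (h : p ∈ x) :
    x ∩ Finset.Ico p (p + (r + 1)) = insert p (x ∩ Finset.Ico (p + 1) (p + 1 + r)) := by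
  ext t; simp only [Finset.mem_inter, Finset.mem_Ico, Finset.mem_insert]
  constructor
  · rintro ⟨h1, h2⟩; by_cases h3 : t = p
    · exact Or.inl h3
    · exact Or.inr ⟨h1, by omega⟩
  · rintro (rfl | ⟨h1, h2⟩)
    · exact ⟨h, by omega⟩
    · exact ⟨h1, by omega⟩

theorem inter_Ico_of_notMem {x : Finset ℕ} {r p : ℕ} (h : p ∉ x) :
    x ∩ Finset.Ico p (p + (r + 1)) = x ∩ Finset.Ico (p + 1) (p + 1 + r) := by
  ext t; simp only [Finset.mem_inter, Finset.mem_Ico]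
  constructor
  · rintro ⟨h1, h2⟩
    have : t ≠ p := by rintro rfl; exact h h1
    exact ⟨h1, by omega⟩
  · rintro ⟨h1, h2⟩
    exact ⟨h1, by omega⟩

/-- The product is expanded one factor at a time, z being the set of variables already chosen. The
summand with coefficient v replaces p by c < p, or omits p, or omits both a and p; each gives a
lower set, so `IsTriangular.add` applies. -/
theorem isTriangular_klProd (x : Finset ℕ) {r p : ℕ} {st : List ℕ} {q : Option ℕ} {z : Finset ℕ}
    (hp : 1 ≤ p) (hpr : p + r ≤ n + 1) (hz : ∀ a ∈ z, 1 ≤ a ∧ a < p) (hnd : st.Nodup)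
    (hst : ∀ c ∈ st, 1 ≤ c ∧ c < p ∧ c ∉ z)
    (hq : ∀ a ∈ q, 1 ≤ a ∧ a < p ∧ a ∉ z ∧ a ∉ st) :
    IsTriangular n (z ∪ q.toFinset ∪ (x ∩ Finset.Ico p (p + r)))
      (setMonomial z * klProd x r p st q) := by
  induction r generalizing p st q z with
  | zero =>
    rw [add_zero, Finset.Ico_self, Finset.inter_empty, Finset.union_empty]
    cases q with
    | none => simpa [klProd] using isTriangular_setMonomial z
    | some a =>
      have e : z ∪ (some a).toFinset = insert a z := by ext; simp
      rw [klProd, e, mul_comm, ← setMonomial_insert (hq a rfl).2.2.1]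
      exact isTriangular_setMonomial _
  | succ r ih =>
    have hpz : p ∉ z := fun h => (hz p h).2.false
    have hz' : ∀ a ∈ z, 1 ≤ a ∧ a < p + 1 := fun a ha => by have := hz a ha; omega
    have ih' := fun {st q z} => ih (p := p + 1) (st := st) (q := q) (z := z) (by omega) (by omega)
    set tail := x ∩ Finset.Ico (p + 1) (p + 1 + r) with htail
    have ht : ∀ a ∈ tail, p < a ∧ a ≤ n := fun a ha => by
      rw [htail, Finset.mem_inter, Finset.mem_Ico] at ha; omega
    by_cases hx : p ∈ x
    · rw [inter_Ico_of_mem hx, ← htail]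
      cases st with
      | nil =>
        cases q with
        | none =>
          by_cases hev : Even p
          · rw [klProd_nil_none_of_even hx hev]
            convert ih' (st := []) (q := some p) (z := z) hz' (by simp) (by simp) ?_ using 1
            · ext t; simp only [Finset.mem_union, Finset.mem_insert, Option.mem_toFinset,
                Option.mem_def, reduceCtorEq, Option.some.injEq]; grind
            · rintro a ⟨⟩; exact ⟨hp, by omega, hpz, by simp⟩
          · rw [klProd_nil_none_of_not_even hx hev]
            have h1 := ih' (st := []) (q := none) (z := insert p z)
              (by simp only [Finset.mem_insert]; grind) (by simp) (by simp) (by simp)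
            have h2 := ih' (st := []) (q := none) (z := z) hz' (by simp) (by simp) (by simp)
            have h3 : Lower n (z ∪ tail) (insert p (z ∪ tail)) := by
              refine lower_insert (fun a ha => ?_) hp (by omega) ?_
              · rw [Finset.mem_union] at ha; rw [Finset.mem_Icc]; grind
              · rw [Finset.mem_union]; grind
            simp only [Option.toFinset_none, Finset.union_empty] at h1 h2 ⊢
            rw [Finset.insert_union] at h1
            rw [Finset.union_insert]
            convert h1.add h2 h3 using 1
            rw [setMonomial_insert hpz]; ring
        | some a =>
          obtain ⟨ha1, hap, haz, -⟩ := hq a rfl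
          rw [klProd_nil_some_of_mem hx]
          have hpaz : a ∉ insert p z := by simp only [Finset.mem_insert]; grind
          have h1 := ih' (st := []) (q := none) (z := insert a (insert p z))
            (by simp only [Finset.mem_insert]; grind) (by simp) (by simp) (by simp)
          have h2 := ih' (st := []) (q := none) (z := z) hz' (by simp) (by simp) (by simp)
          have hs : z ∪ tail ⊆ Finset.Icc 1 n := fun b hb => by
            rw [Finset.mem_union] at hb; rw [Finset.mem_Icc]; grind
          have hpt : p ∉ z ∪ tail := by rw [Finset.mem_union]; grind
          have h3 : Lower n (z ∪ tail) (insert a (insert p (z ∪ tail))) := by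
            refine (lower_insert hs hp (by omega) hpt).trans
              (lower_insert (Finset.insert_subset (Finset.mem_Icc.2 (by omega)) hs) ha1
                (by omega) ?_)
            simp only [Finset.mem_insert, Finset.mem_union]; grind
          simp only [Option.toFinset_none, Finset.union_empty, Finset.insert_union] at h1 h2
          convert h1.add h2 h3 using 1
          · ext t; simp only [Finset.mem_union, Finset.mem_insert, Option.mem_toFinset,
              Option.mem_def, Option.some.injEq]; grind
          · rw [setMonomial_insert hpaz, setMonomial_insert hpz]; ring
      | cons c st =>
        obtain ⟨hc1, hcp, hcz⟩ := hst c (by simp)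
        rw [List.nodup_cons] at hnd
        have hqc : ∀ a ∈ q, 1 ≤ a ∧ a < p ∧ a ∉ z ∧ a ≠ c ∧ a ∉ st := fun a ha => by
          have := hq a ha; simp only [List.mem_cons, not_or] at this; exact this
        have hst' : ∀ b ∈ st, 1 ≤ b ∧ b < p ∧ b ∉ z := fun b hb => hst b (by simp [hb])
        rw [klProd_cons_of_mem hx, cup]
        have h1 := ih' (st := st) (q := q) (z := insert p z)
          (by simp only [Finset.mem_insert]; grind) hnd.2
          (by simp only [Finset.mem_insert]; grind) (by simp only [Finset.mem_insert]; grind)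
        have h2 := ih' (st := st) (q := q) (z := insert c z)
          (by simp only [Finset.mem_insert]; grind) hnd.2
          (by simp only [Finset.mem_insert]; grind) (by simp only [Finset.mem_insert]; grind)
        have h3 : Lower n (insert c (z ∪ q.toFinset ∪ tail)) (insert p (z ∪ q.toFinset ∪ tail)) := by
          refine lower_insert_insert (fun a ha => ?_) hc1 hcp (by omega) ?_ ?_
          · simp only [Finset.mem_union, Option.mem_toFinset] at ha; rw [Finset.mem_Icc]; grind
          · simp only [Finset.mem_union, Option.mem_toFinset]; grind
          · simp only [Finset.mem_union, Option.mem_toFinset]; grind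
        simp only [Finset.insert_union] at h1 h2
        rw [Finset.union_insert]
        convert h1.add h2 h3 using 1
        rw [setMonomial_insert hpz, setMonomial_insert hcz]; ring
    · rw [inter_Ico_of_notMem hx, klProd_of_notMem hx]
      exact ih' hz' (List.nodup_cons.2 ⟨fun h => (hst p h).2.1.false, hnd⟩)
        (by simp only [List.mem_cons]; grind) (by simp only [List.mem_cons]; grind)

variable {W : Type*} [Group W] (cs : CoxeterSystem (typeB n) W)

theorem ofPoly_setMonomial (z : Finset ℕ) : ofPoly cs (setMonomial z) = stdElt cs z := by
  have key : ∃ m : ℕ →₀ ℕ, m.support = z ∧ setMonomial z = monomial m 1 := by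
    induction z using Finset.induction_on with
    | empty => exact ⟨0, by simp, by simp [setMonomial]⟩
    | insert a z ha ih =>
      obtain ⟨m, hm, e⟩ := ih
      refine ⟨m + Finsupp.single a 1, ?_, ?_⟩
      · ext j
        simp only [← hm, Finsupp.mem_support_iff, Finsupp.add_apply, Finset.mem_insert,
          Finsupp.single_apply]
        grind
      · rw [setMonomial_insert ha, e, X, monomial_mul, mul_one, add_comm]
  obtain ⟨m, hm, e⟩ := key
  rw [e, ofPoly_monomial, hm]

/-- The Kazhdan–Lusztig element attached to a subset of `{1, …, n}`. -/
def klElt (x : Finset ℕ) : Antisph cs (typeA n) := ofPoly cs (klProd x n 1 [] none)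

theorem klElt_sub_mem {x : Finset ℕ} (hx : x ⊆ Finset.Icc 1 n) :
    klElt cs x - stdElt cs x ∈ AddSubgroup.closure
      {m | ∃ (y : MinCosetRep cs (typeA n)) (k : ℕ), BruhatLT cs y.1 (ofSubset cs x).1 ∧ 1 ≤ k ∧
        m = oneTensor cs (typeA n) (scalar cs (T k) * δ cs y.1)} := by
  have h := isTriangular_klProd (n := n) x (r := n) (p := 1) (st := []) (q := none) (z := ∅)
    le_rfl (by omega) (by simp) (by simp) (by simp) (by simp)
  have e : x ∩ Finset.Ico 1 (1 + n) = x := by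
    refine Finset.inter_eq_left.2 (hx.trans fun t ht => ?_)
    rw [Finset.mem_Icc] at ht; rw [Finset.mem_Ico]; omega
  simp only [Option.toFinset_none, Finset.empty_union, setMonomial, Finset.prod_empty, one_mul,
    e] at h
  rw [klElt, ← ofPoly_setMonomial, ← map_sub]
  refine AddSubgroup.closure_induction (p := fun m _ => ofPoly cs m ∈ _) ?_ ?_ ?_ ?_ h
  · rintro _ ⟨y, k, hy, hk, rfl⟩
    refine AddSubgroup.subset_closure ⟨ofSubset cs y, k, hy.bruhatLT cs, hk, ?_⟩
    rw [ofPoly_C_mul, ← smul_oneTensor, ← stdElt_eq]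
    exact congrArg _ (ofPoly_setMonomial cs y)
  · rw [map_zero]; exact zero_mem _
  · intro a b _ _ ha hb; rw [map_add]; exact add_mem ha hb
  · intro a _ ha; rw [map_neg]; exact neg_mem ha

theorem ofPoly_cupProd {x : Finset ℕ} (hx : x ⊆ Finset.Icc 1 n) :
    ofPoly cs (cupProd x n 1 []) = ∑ E ∈ (defectSet x).powerset, klElt cs (x \ E) := by
  rw [cupProd_eq_sum, map_sum, evenUnmatched_eq_defectSet hx]; rfl

theorem barN_stdElt_empty_smul_bWord (ω : List (Fin n)) :
    barN cs _ (stdElt cs ∅ <• bWord cs ω) = stdElt cs ∅ <• bWord cs ω := by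
  rw [barN_op_smul, stdElt_empty, barN_oneTensor, map_one, bWord, map_list_prod, List.map_map]
  congr 4
  funext i
  exact bar_b cs i

/-- The Bott–Samelson element of x is self-dual and equals this element plus those of x \ E for
nonempty E ⊆ E(x). The latter are self-dual by induction on the cardinality and cancel. -/
theorem barN_klElt {x : Finset ℕ} (hx : x ⊆ Finset.Icc 1 n) :
    barN cs _ (klElt cs x) = klElt cs x := by
  induction hN : x.card using Nat.strong_induction_on generalizing x with
  | _ N ih =>
  obtain ⟨ω, hω, e⟩ := cs.exists_isReduced (ofSubset cs x).1
  have h1 := stdElt_smul_bWord cs hω (e ▸ (ofSubset cs x).2)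
  rw [← e, subsetOf_ofSubset cs hx] at h1
  have h2 := barN_stdElt_empty_smul_bWord cs ω
  have h3 := Finset.add_sum_erase (defectSet x).powerset (fun E => klElt cs (x \ E))
    (Finset.empty_mem_powerset _)
  simp only [Finset.sdiff_empty] at h3
  rw [h1, ofPoly_cupProd cs hx, ← h3, map_add, map_sum, Finset.sum_congr rfl fun E hE => ?_] at h2
  · exact add_right_cancel h2
  · rw [Finset.mem_erase, Finset.mem_powerset] at hE
    have hEx : E ⊆ x := hE.2.trans (Finset.filter_subset _ _)
    refine ih _ ?_ (Finset.sdiff_subset.trans hx) rfl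
    rw [← hN]
    exact Finset.card_lt_card (Finset.sdiff_ssubset hEx (Finset.nonempty_iff_ne_empty.2 hE.1))

/-- The Kazhdan–Lusztig basis of the antispherical module. -/
def klBasis (y : MinCosetRep cs (typeA n)) : Antisph cs (typeA n) := klElt cs (subsetOf cs y.1)

theorem isKLBasis_klBasis : IsKLBasis cs (typeA n) (klBasis cs) := fun y => by
  have hx := subsetOf_subset_Icc cs y.1
  refine ⟨barN_klElt cs hx, ?_⟩
  have h := klElt_sub_mem cs hx
  rwa [ofSubset_subsetOf, stdElt, ofSubset_subsetOf] at h

theorem klBasis_ofSubset {x : Finset ℕ} (hx : x ⊆ Finset.Icc 1 n) :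
    klBasis cs (ofSubset cs x) = klElt cs x := by
  rw [klBasis, subsetOf_ofSubset cs hx]

theorem klBasis_idRep : klBasis cs (idRep cs _) = stdElt cs ∅ := by
  have h := ofPoly_cupProd cs (Finset.empty_subset (Finset.Icc 1 n))
  rw [cupProd_empty] at h
  have h2 := ofPoly_setMonomial cs ∅
  rw [setMonomial, Finset.prod_empty, h] at h2
  rw [klBasis, idRep, subsetOf_one, ← h2]
  simp [defectSet]

theorem bottSamelson_klBasis (x : MinCosetRep cs (typeA n)) {ω : List (Fin n)}
    (hω : cs.IsReduced ω) (h : cs.wordProd ω = x.1) :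
    bottSamelson cs (typeA n) (klBasis cs) ω =
      ∑ E ∈ (defectSet (subsetOf cs x.1)).powerset,
        klBasis cs (ofSubset cs (subsetOf cs x.1 \ E)) := by
  have hx := subsetOf_subset_Icc cs x.1
  rw [bottSamelson, klBasis_idRep, stdElt_smul_bWord cs hω (h ▸ x.2), h, ofPoly_cupProd cs hx]
  exact Finset.sum_congr rfl fun E _ =>
    (klBasis_ofSubset cs (Finset.sdiff_subset.trans hx)).symm

end Triangular

end Antispherical

end

theorem mainTheorem6 (n : ℕ) {W : Type*} [Group W]
    (cs : CoxeterSystem (Antispherical.typeB n) W) :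
    ∃ d : Antispherical.MinCosetRep cs (Antispherical.typeA n) →
        Antispherical.Antisph cs (Antispherical.typeA n),
      (Antispherical.IsKLBasis cs (Antispherical.typeA n) d ∧
        ∀ d', Antispherical.IsKLBasis cs (Antispherical.typeA n) d' → d' = d) ∧
      ∀ (x : Antispherical.MinCosetRep cs (Antispherical.typeA n)) (ω : List (Fin n)),
        cs.IsReduced ω → cs.wordProd ω = x.1 →
        Antispherical.bottSamelson cs (Antispherical.typeA n) d ω =
          ∑ E ∈ (Antispherical.defectSet (Antispherical.subsetOf cs x.1)).powerset,
            d (Antispherical.ofSubset cs (Antispherical.subsetOf cs x.1 \ E)) :=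
  ⟨Antispherical.klBasis cs,
    ⟨Antispherical.isKLBasis_klBasis cs, fun _ hd =>
      Antispherical.IsKLBasis.unique cs (Antispherical.isKLBasis_klBasis cs) hd⟩,
    fun x _ hω h => Antispherical.bottSamelson_klBasis cs x hω h⟩
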